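/- Let $\mathbb E^5_1$ be Minkowski 5-space, $\mathbb R^5$ with the metric $\langle\,,\rangle=-dx_1^2+dx_2^2+\dots+dx_5^2$. Let $M$ be a smooth 4-manifold and $x:M\to\mathbb E^5_1$ a smooth immersion whose induced metric is Lorentzian (signature $(-,+,+,+)$), oriented by a smooth unit normal field $N$, $\langle N,N\rangle=1$. Let $S$ be the shape operator, $dx(Sv)=-dN(v)$, let $s_1=\operatorname{tr}S$, and let $\Delta=-\operatorname{div}\nabla$ be the Laplace operator of the induced metric. $M$ is called minimal if $s_1=0$ on $M$, and biharmonic if $\Delta^2x=0$ on $M$ (coordinatewise). Assume that there are smooth functions $k_1,k_3,k_4:M\to\mathbb R$ such that $k_1-k_3$, $k_1-k_4$ and $k_3-k_4$ vanish nowhere on $M$, and that around each point of $M$ there is a smooth frame field $e_1,e_2,e_3,e_4$ which is pseudo-orthonormal, i.e. $\langle e_1,e_1\rangle=\langle e_2,e_2\rangle=0$, $\langle e_1,e_2\rangle=\sigma$ with a constant $\sigma\in\{1,-1\}$, $\langle e_A,e_a\rangle=0$ and $\langle e_a,e_b\rangle=\delta_{ab}$ for $A\in\{1,2\}$, $a,b\in\{3,4\}$,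 and in which $$Se_1=k_1e_1,\qquad Se_2=e_1+k_1e_2,\qquad Se_3=k_3e_3,\qquad Se_4=k_4e_4 .$$ (So $S$ is non-diagonalizable with characteristic polynomial $(t-k_1)^2(t-k_3)(t-k_4)$.) Then $s_1=2k_1+k_3+k_4$, and $M$ is biharmonic if and only if it is minimal. -/

import Mathlib

open scoped Manifold ContDiff

noncomputable section

/-- The underlying vector space of Minkowski 5-space, with its usual smooth structure. -/
abbrev E51 : Type := EuclideanSpace ℝ (Fin 5)

/-- The Minkowski metric `-dx₁² + dx₂² + dx₃² + dx₄² + dx₅²`. -/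
def minkowski : LinearMap.BilinForm ℝ E51 :=
  LinearMap.mk₂ ℝ (fun v w => -(v 0 * w 0) + v 1 * w 1 + v 2 * w 2 + v 3 * w 3 + v 4 * w 4)
    (fun u v w => by simp only [PiLp.add_apply]; ring)
    (fun c v w => by simp only [PiLp.smul_apply, smul_eq_mul]; ring)
    (fun u v w => by simp only [PiLp.add_apply]; ring)
    (fun c v w => by simp only [PiLp.smul_apply, smul_eq_mul]; ring)

section Hypersurface

variable {M : Type*} [TopologicalSpace M] [ChartedSpace (EuclideanSpace ℝ (Fin 4)) M]

instance tangentSpaceFiniteDimensional (p : M) :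
    FiniteDimensional ℝ (TangentSpace (𝓡 4) p) :=
  inferInstanceAs (FiniteDimensional ℝ (EuclideanSpace ℝ (Fin 4)))

/-- The derivative at `p` of a real function on `M`, as a covector. -/
def diffReal (f : M → ℝ) (p : M) : Module.Dual ℝ (TangentSpace (𝓡 4) p) :=
  (mfderiv (𝓡 4) 𝓘(ℝ, ℝ) f p).toLinearMap

/-- The derivative at `p` of a vector-valued function on `M`; `diffVec F p v` is the flat
ambient derivative of `F` in direction `v`. -/
def diffVec (F : M → E51) (p : M) : TangentSpace (𝓡 4) p →ₗ[ℝ] E51 :=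
  (mfderiv (𝓡 4) 𝓘(ℝ, E51) F p).toLinearMap

/-- The metric that the map `x` induces on the tangent spaces of `M`. -/
def inducedMetric (x : M → E51) (p : M) : LinearMap.BilinForm ℝ (TangentSpace (𝓡 4) p) :=
  minkowski.compl₁₂ (diffVec x p) (diffVec x p)

open Classical in
/-- Raising an index with the induced metric: `sharp x p φ` is the tangent vector `v` with
`⟨v, u⟩ = φ u` for all `u` (the zero map where the induced metric degenerates). -/
def sharp (x : M → E51) (p : M) :
    Module.Dual ℝ (TangentSpace (𝓡 4) p) →ₗ[ℝ] TangentSpace (𝓡 4) p :=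
  if h : (inducedMetric x p).Nondegenerate then
    ((inducedMetric x p).toDual h).symm.toLinearMap
  else 0

/-- The tangential part of an ambient vector `w` at `p`: the tangent vector `v` with
`⟨dx v, dx u⟩ = ⟨w, dx u⟩` for all tangent vectors `u`. -/
def tangentialPart (x : M → E51) (p : M) : E51 →ₗ[ℝ] TangentSpace (𝓡 4) p :=
  sharp x p ∘ₗ (minkowski.compl₂ (diffVec x p))

/-- The Levi-Civita connection of the induced metric, by the Gauss formula: `∇_v X` is the
tangential part of the ambient derivative of `dx X` in direction `v`. -/
def covDeriv (x : M → E51) (X : (q : M) → TangentSpace (𝓡 4) q) (p : M) :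
    TangentSpace (𝓡 4) p →ₗ[ℝ] TangentSpace (𝓡 4) p :=
  tangentialPart x p ∘ₗ diffVec (fun q => diffVec x q (X q)) p

/-- The gradient of a function with respect to the induced metric. -/
def metricGradient (x : M → E51) (f : M → ℝ) (p : M) : TangentSpace (𝓡 4) p :=
  sharp x p (diffReal f p)

/-- The divergence of a tangent vector field, the trace of `v ↦ ∇_v X`. -/
def divergence (x : M → E51) (X : (q : M) → TangentSpace (𝓡 4) q) (p : M) : ℝ :=
  LinearMap.trace ℝ (TangentSpace (𝓡 4) p) (covDeriv x X p)

/-- The Laplace operator of the induced metric, with the sign `Δ = -div ∇`. -/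
def laplace (x : M → E51) (f : M → ℝ) (p : M) : ℝ :=
  -divergence x (metricGradient x f) p

/-- `x : M → E⁵₁` is a Lorentzian hypersurface: a smooth immersion of a 4-manifold whose induced
metric has signature `(-,+,+,+)` at each point. -/
structure IsLorentzianHypersurface (x : M → E51) : Prop where
  smooth : ContMDiff (𝓡 4) 𝓘(ℝ, E51) ∞ x
  immersion : ∀ p, Function.Injective (diffVec x p)
  lorentzian : ∀ p, ∃ b : Module.Basis (Fin 4) ℝ (TangentSpace (𝓡 4) p),
    ∀ i j, inducedMetric x p (b i) (b j) = if i = j then (if i = 0 then -1 else 1) else 0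

/-- `N` is a smooth unit normal vector field of `x`, that is, an orientation of the
hypersurface. -/
structure IsUnitNormal (x N : M → E51) : Prop where
  smooth : ContMDiff (𝓡 4) 𝓘(ℝ, E51) ∞ N
  unit : ∀ p, minkowski (N p) (N p) = 1
  normal : ∀ p v, minkowski (N p) (diffVec x p v) = 0

/-- The shape operator with respect to `N`, by the Weingarten formula: `S v` is the tangential
part of `-dN v`. -/
def shapeOperator (x N : M → E51) (p : M) :
    TangentSpace (𝓡 4) p →ₗ[ℝ] TangentSpace (𝓡 4) p :=
  -(tangentialPart x p ∘ₗ diffVec N p)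

/-- The (first) mean curvature `s₁ = tr S`. -/
def meanCurvature (x N : M → E51) (p : M) : ℝ :=
  LinearMap.trace ℝ (TangentSpace (𝓡 4) p) (shapeOperator x N p)

/-- `M` is minimal if `s₁` vanishes identically. -/
def IsMinimal (x N : M → E51) : Prop :=
  ∀ p, meanCurvature x N p = 0

/-- `M` is biharmonic if `Δ² x = 0`, where `Δ` acts on each coordinate function of `x`. -/
def IsBiharmonic (x : M → E51) : Prop :=
  ∀ (i : Fin 5) (p : M), laplace x (laplace x (fun q => x q i)) p = 0

/-- `e 0, e 1, e 2, e 3` is a smooth pseudo-orthonormal frame field on `U`: `e 0` and `e 1` are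
lightlike with product `σ = ±1`, and `e 2`, `e 3` are orthonormal and orthogonal to them.
(Both normalizations of the product of the lightlike pair occur in the literature.) -/
structure IsPseudoOrthonormalFrameOn [IsManifold (𝓡 4) ∞ M] (x : M → E51) (U : Set M) (σ : ℝ)
    (e : Fin 4 → (q : M) → TangentSpace (𝓡 4) q) : Prop where
  smooth : ∀ i, ContMDiffOn (𝓡 4) (𝓡 4).tangent ∞
    (fun q => (⟨q, e i q⟩ : TangentBundle (𝓡 4) M)) U
  sign : σ = 1 ∨ σ = -1
  metric : ∀ q ∈ U, ∀ i j, inducedMetric x q (e i q) (e j q) =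
    (!![0, σ, 0, 0;
        σ, 0, 0, 0;
        0, 0, 1, 0;
        0, 0, 0, 1] : Matrix (Fin 4) (Fin 4) ℝ) i j

/-- The shape operator is of the non-diagonalizable form
`S e₁ = k₁ e₁`, `S e₂ = e₁ + k₁ e₂`, `S e₃ = k₃ e₃`, `S e₄ = k₄ e₄`
for smooth functions `k₁, k₃, k₄`, in a pseudo-orthonormal frame field around each point. -/
structure HasCaseIShapeOperator [IsManifold (𝓡 4) ∞ M] (x N : M → E51) (k₁ k₃ k₄ : M → ℝ) : Prop where
  smooth₁ : ContMDiff (𝓡 4) 𝓘(ℝ, ℝ) ∞ k₁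
  smooth₃ : ContMDiff (𝓡 4) 𝓘(ℝ, ℝ) ∞ k₃
  smooth₄ : ContMDiff (𝓡 4) 𝓘(ℝ, ℝ) ∞ k₄
  frame : ∀ p : M, ∃ (U : Set M) (σ : ℝ) (e : Fin 4 → (q : M) → TangentSpace (𝓡 4) q),
    IsOpen U ∧ p ∈ U ∧ IsPseudoOrthonormalFrameOn x U σ e ∧
    ∀ q ∈ U,
      shapeOperator x N q (e 0 q) = k₁ q • e 0 q ∧
      shapeOperator x N q (e 1 q) = e 0 q + k₁ q • e 1 q ∧
      shapeOperator x N q (e 2 q) = k₃ q • e 2 q ∧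
      shapeOperator x N q (e 3 q) = k₄ q • e 3 q

end Hypersurface

end

/-! Everything rests on `Δx = -s₁ N` (`frameLaplace_position`). It makes a minimal hypersurface
harmonic, hence biharmonic. For the converse, suppose `s₁ ≠ 0` at a point and restrict to the open
part of a frame domain where this holds. The normal and tangential parts of `Δ(s₁ N) = 0` are `Δs₁ +
s₁ tr S² = 0` and `S∇s₁ = -(s₁/2)∇s₁` (`biharmonic_normal`, `biharmonic_tangential`). If `∇s₁ = 0`
throughout, the first gives `s₁ (2k₁² + k₃² + k₄²) = 0`, so all principal curvatures vanish,
although they are distinct. Otherwise `∇s₁` is somewhere an eigenvector for the eigenvalue `-s₁/2`,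
which is one of `k₁`, `k₃`, `k₄`.

Eigenvalue `k₁`: the gradient is lightlike, along the eigenvector of the Jordan block.
Differentiating `k₃ + k₄ = -4k₁` twice along that eigenvector kills two connection coefficients; the
Gauss equation then yields `k₁k₃ = k₁k₄ = 0`, so `k₁ = 0` and `s₁ = 0`
(`eq_zero_of_jordan_eigenvalue`).

Eigenvalue `k₃` (or `k₄`, by symmetry): Codazzi, Gauss and the normal equation give a closed
differential system along the gradient direction for the curvatures and two connection coefficients
`p`, `q` (`exists_system_of_simple_eigenvalue`). It is overdetermined because `3k₃ = -2k₁ - k₄`.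
Repeated differentiation eliminates `p` and `q` and leaves a nontrivial homogeneous polynomial
equation in `k₁ - k₃` and `k₃` (`elimResultant_eq_zero`). So the ratio of these takes finitely many
values and by continuity is locally constant, which a positivity argument excludes
(`not_constant_ratio`).

The local computations take place in a commutative `ℝ`-algebra, later that of smooth functions on an
open set, with the frame acting by derivations. Cancellation hypotheses replace division. Frame
indices 0, 1 are the lightlike pair, and 2, 3 belong to `k₃`, `k₄`. -/

noncomputable section

/-! ### Algebraic hypersurface theory: Gauss and Codazzi equations of a frame of derivations. -/

section AdaptedFrame

variable {A : Type*} [CommRing A]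

/-- The Minkowski product of two 5-vectors over a commutative ring. -/
def minkowskiForm (u v : Fin 5 → A) : A :=
  -(u 0 * v 0) + u 1 * v 1 + u 2 * v 2 + u 3 * v 3 + u 4 * v 4

theorem minkowskiForm_comm (u v : Fin 5 → A) : minkowskiForm u v = minkowskiForm v u := by
  simp only [minkowskiForm]; ring

theorem minkowskiForm_sum_left {ι : Type*} (s : Finset ι) (c : ι → A) (u : ι → Fin 5 → A)
    (v : Fin 5 → A) :
    minkowskiForm (fun m => ∑ i ∈ s, c i * u i m) v = ∑ i ∈ s, c i * minkowskiForm (u i) v := by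
  simp only [minkowskiForm, Finset.sum_mul, mul_add, Finset.sum_add_distrib, mul_neg,
    Finset.sum_neg_distrib, mul_assoc]

theorem minkowskiForm_neg_left (u v : Fin 5 → A) :
    minkowskiForm (fun m => -u m) v = -minkowskiForm u v := by
  simp only [minkowskiForm]; ring

theorem minkowskiForm_sub_left (u v w : Fin 5 → A) :
    minkowskiForm (fun m => u m - v m) w = minkowskiForm u w - minkowskiForm v w := by
  simp only [minkowskiForm]; ring

theorem minkowskiForm_add_left (u v w : Fin 5 → A) :
    minkowskiForm (fun m => u m + v m) w = minkowskiForm u w + minkowskiForm v w := by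
  simp only [minkowskiForm]; ring

theorem minkowskiForm_mul_left (a : A) (u w : Fin 5 → A) :
    minkowskiForm (fun m => a * u m) w = a * minkowskiForm u w := by
  simp only [minkowskiForm]; ring

theorem minkowskiForm_zero_left (W : Fin 5 → A) : minkowskiForm (fun _ => 0) W = 0 := by
  simp [minkowskiForm]

variable [Algebra ℝ A]

/-- A derivation acting on 5-vectors coordinatewise. -/
def vecDeriv (D : Derivation ℝ A A) (u : Fin 5 → A) : Fin 5 → A := fun m => D (u m)

/-- The lowered connection coefficients `⟨∇ᵢ eⱼ, eₖ⟩` of the frame `eⱼ = Dⱼ x`. -/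
def connCoeff (D : Fin 4 → Derivation ℝ A A) (x : Fin 5 → A) (i j k : Fin 4) : A :=
  minkowskiForm (vecDeriv (D i) (vecDeriv (D j) x)) (vecDeriv (D k) x)

/-- The derivations `D i` form a frame of a hypersurface `x` with unit normal `N`, constant
metric coefficients `η` and shape operator `S eᵢ = ∑ⱼ S i j eⱼ`. -/
structure IsAdaptedFrame (D : Fin 4 → Derivation ℝ A A) (x N : Fin 5 → A)
    (η : Fin 4 → Fin 4 → ℝ) (S : Fin 4 → Fin 4 → A) : Prop where
  symm : ∀ i j, η i j = η j i
  -- The matrix `η` is its own inverse, so it both lowers and raises indices.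
  sq : ∀ i j, ∑ k, η i k * η k j = if i = j then 1 else 0
  metric : ∀ i j, minkowskiForm (vecDeriv (D i) x) (vecDeriv (D j) x) = algebraMap ℝ A (η i j)
  unit : minkowskiForm N N = 1
  normal : ∀ i, minkowskiForm N (vecDeriv (D i) x) = 0
  weingarten : ∀ i m, D i (N m) = -∑ j, S i j * D j (x m)
  torsion : ∀ i j f, D i (D j f) - D j (D i f) =
    ∑ k, (∑ l, algebraMap ℝ A (η k l) * (connCoeff D x i j l - connCoeff D x j i l)) * D k f

theorem deriv_minkowskiForm (D : Derivation ℝ A A) (u v : Fin 5 → A) :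
    D (minkowskiForm u v) = minkowskiForm (vecDeriv D u) v + minkowskiForm u (vecDeriv D v) := by
  simp only [minkowskiForm, vecDeriv, map_add, map_neg, Derivation.leibniz, smul_eq_mul]; ring

/-- Every 5-vector is the sum of its components along a pseudo-orthonormal frame and its
normal. -/
theorem minkowskiForm_expand {E : Fin 4 → Fin 5 → A} {N : Fin 5 → A} {η : Fin 4 → Fin 4 → ℝ}
    (hsymm : ∀ i j, η i j = η j i) (hsq : ∀ i j, ∑ k, η i k * η k j = if i = j then 1 else 0)
    (hmetric : ∀ i j, minkowskiForm (E i) (E j) = algebraMap ℝ A (η i j))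
    (hunit : minkowskiForm N N = 1) (hnormal : ∀ i, minkowskiForm N (E i) = 0)
    (v : Fin 5 → A) (m : Fin 5) :
    v m = ∑ k, (∑ l, algebraMap ℝ A (η k l) * minkowskiForm v (E l)) * E k m +
      minkowskiForm v N * N m := by
  -- With the frame and the normal as the rows of `F`, the Gram matrix `F J Fᵀ = H` squares to 1.
  -- Thus `J Fᵀ H` is a right inverse of the square matrix `F`, hence also a left inverse, and no
  -- division is needed.
  let J : Fin 5 → A := ![-1, 1, 1, 1, 1]
  let F : Matrix (Fin 4 ⊕ Unit) (Fin 5) A :=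
    Matrix.of (Sum.elim E (fun _ m => N m))
  let H : Matrix (Fin 4 ⊕ Unit) (Fin 4 ⊕ Unit) A :=
    Matrix.fromBlocks (Matrix.of fun k l => algebraMap ℝ A (η k l)) 0 0 1
  have hform : ∀ u w : Fin 5 → A, ∑ m, u m * (J m * w m) = minkowskiForm u w := by
    intro u w
    simp only [Fin.sum_univ_five, minkowskiForm, J]
    simp
  have hG : F * (Matrix.diagonal J * F.transpose) = H := by
    ext a b
    rw [Matrix.mul_apply]
    simp only [Matrix.diagonal_mul, Matrix.transpose_apply]
    rw [hform]
    rcases a with a | a <;> rcases b with b | b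
    · exact hmetric a b
    · exact (minkowskiForm_comm _ _).trans (hnormal a)
    · exact hnormal b
    · exact hunit
  have hH : H * H = 1 := by
    have : (Matrix.of fun k l => algebraMap ℝ A (η k l)) * (Matrix.of fun k l =>
        algebraMap ℝ A (η k l)) = 1 := by
      ext k l
      simp only [Matrix.mul_apply, Matrix.of_apply, ← map_mul, ← map_sum, hsq, Matrix.one_apply]
      split_ifs <;> simp
    simp only [H, Matrix.fromBlocks_multiply, this]
    simp
  have h1 : F * (Matrix.diagonal J * F.transpose * H) = 1 := by
    rw [← Matrix.mul_assoc, hG, hH]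
  have h2 : Matrix.diagonal J * F.transpose * H * F = 1 :=
    (Matrix.mul_eq_one_comm_of_card_eq _ _ _ (by simp)).1 h1
  have h3 : Matrix.vecMul v (Matrix.diagonal J * F.transpose * H * F) m = v m := by
    rw [h2, Matrix.vecMul_one]
  rw [← h3, ← Matrix.vecMul_vecMul, ← Matrix.vecMul_vecMul]
  have h4 : ∀ a, Matrix.vecMul v (Matrix.diagonal J * F.transpose) a =
      minkowskiForm v (F a) := by
    intro a
    rw [← hform]
    simp only [Matrix.vecMul, dotProduct, Matrix.diagonal_mul, Matrix.transpose_apply]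
  simp only [Matrix.vecMul, dotProduct, Fintype.sum_sum_type] at h4 ⊢
  simp only [h4, H, F, Matrix.fromBlocks_apply₁₁, Matrix.fromBlocks_apply₂₁,
    Matrix.fromBlocks_apply₁₂, Matrix.fromBlocks_apply₂₂, Matrix.of_apply, Sum.elim_inl,
    Sum.elim_inr, Matrix.zero_apply, mul_zero, Finset.sum_const_zero, add_zero,
    zero_add, Finset.univ_unique, Finset.sum_singleton, Matrix.one_apply_eq, mul_one]
  congr 1
  refine Finset.sum_congr rfl fun k _ => ?_
  congr 1
  refine Finset.sum_congr rfl fun l _ => ?_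
  rw [hsymm k l, mul_comm]
  rfl

namespace IsAdaptedFrame

variable {D : Fin 4 → Derivation ℝ A A} {x N : Fin 5 → A}
  {η : Fin 4 → Fin 4 → ℝ} {S : Fin 4 → Fin 4 → A}

theorem expand (h : IsAdaptedFrame D x N η S) (v : Fin 5 → A) (m : Fin 5) :
    v m = ∑ k, (∑ l, algebraMap ℝ A (η k l) * minkowskiForm v (vecDeriv (D l) x)) * D k (x m) +
      minkowskiForm v N * N m :=
  minkowskiForm_expand h.symm h.sq h.metric h.unit h.normal v m

theorem parseval (h : IsAdaptedFrame D x N η S) (u v : Fin 5 → A) :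
    minkowskiForm u v = ∑ k, (∑ l, algebraMap ℝ A (η k l) * minkowskiForm u (vecDeriv (D l) x)) *
      minkowskiForm v (vecDeriv (D k) x) + minkowskiForm u N * minkowskiForm v N := by
  have hu : u = fun m =>
      ∑ k, (∑ l, algebraMap ℝ A (η k l) * minkowskiForm u (vecDeriv (D l) x)) * D k (x m) +
      minkowskiForm u N * N m := funext fun m => h.expand u m
  conv_lhs => rw [hu]
  rw [minkowskiForm_add_left, minkowskiForm_mul_left]
  rw [show minkowskiForm (fun m => ∑ k, (∑ l, algebraMap ℝ A (η k l) *
      minkowskiForm u (vecDeriv (D l) x)) * D k (x m)) v = _ from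
    minkowskiForm_sum_left Finset.univ _ (fun k => vecDeriv (D k) x) v]
  simp only [minkowskiForm_comm v]

theorem connCoeff_antisymm (h : IsAdaptedFrame D x N η S) (i j k : Fin 4) :
    connCoeff D x i j k = -connCoeff D x i k j := by
  have := congrArg (D i) (h.metric j k)
  rw [deriv_minkowskiForm, Derivation.map_algebraMap,
    minkowskiForm_comm (vecDeriv (D j) x)] at this
  exact eq_neg_of_add_eq_zero_left this

theorem weingarten_form (h : IsAdaptedFrame D x N η S) (i : Fin 4) (v : Fin 5 → A) :
    minkowskiForm (vecDeriv (D i) N) v = -∑ j, S i j * minkowskiForm (vecDeriv (D j) x) v := by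
  have : vecDeriv (D i) N = fun m => -∑ j, S i j * vecDeriv (D j) x m :=
    funext fun m => h.weingarten i m
  rw [this, minkowskiForm_neg_left, minkowskiForm_sum_left]

/-- The second fundamental form. -/
theorem second_form (h : IsAdaptedFrame D x N η S) (i j : Fin 4) :
    minkowskiForm (vecDeriv (D i) (vecDeriv (D j) x)) N =
      ∑ k, S i k * algebraMap ℝ A (η k j) := by
  have := congrArg (D i) (h.normal j)
  rw [deriv_minkowskiForm, h.weingarten_form, map_zero, minkowskiForm_comm N] at this
  simp only [h.metric] at this
  exact (neg_add_eq_zero.1 this).symm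

/-- The Gauss equation. -/
theorem gauss (h : IsAdaptedFrame D x N η S) (i j k l : Fin 4) :
    D i (connCoeff D x j k l) - D j (connCoeff D x i k l)
      - minkowskiForm (vecDeriv (D j) (vecDeriv (D k) x)) (vecDeriv (D i) (vecDeriv (D l) x))
      + minkowskiForm (vecDeriv (D i) (vecDeriv (D k) x)) (vecDeriv (D j) (vecDeriv (D l) x)) =
    ∑ n, (∑ o, algebraMap ℝ A (η n o) * (connCoeff D x i j o - connCoeff D x j i o)) *
      connCoeff D x n k l := by
  -- The ambient space is flat: the bracket identity is applied to each coordinate of `eₖ` and the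
  -- result is paired with `eₗ`.
  have h1 := minkowskiForm_sum_left Finset.univ
    (fun n => ∑ o, algebraMap ℝ A (η n o) * (connCoeff D x i j o - connCoeff D x j i o))
    (fun n => vecDeriv (D n) (vecDeriv (D k) x)) (vecDeriv (D l) x)
  have h2 : (fun m => ∑ n, (∑ o, algebraMap ℝ A (η n o) *
      (connCoeff D x i j o - connCoeff D x j i o)) * vecDeriv (D n) (vecDeriv (D k) x) m) =
      fun m => vecDeriv (D i) (vecDeriv (D j) (vecDeriv (D k) x)) m -
        vecDeriv (D j) (vecDeriv (D i) (vecDeriv (D k) x)) m :=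
    funext fun m => (h.torsion i j (D k (x m))).symm
  rw [h2, minkowskiForm_sub_left] at h1
  rw [show (∑ n, (∑ o, algebraMap ℝ A (η n o) * (connCoeff D x i j o - connCoeff D x j i o)) *
      connCoeff D x n k l) = _ from h1.symm]
  simp only [connCoeff, deriv_minkowskiForm]
  ring

theorem weingarten_metric (h : IsAdaptedFrame D x N η S) (i k : Fin 4) :
    minkowskiForm (vecDeriv (D i) N) (vecDeriv (D k) x) =
      -∑ a, S i a * algebraMap ℝ A (η a k) := by
  rw [h.weingarten_form]
  simp only [h.metric]

theorem weingarten_deriv (h : IsAdaptedFrame D x N η S) (i j k : Fin 4) :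
    minkowskiForm (vecDeriv (D i) (vecDeriv (D j) N)) (vecDeriv (D k) x) =
      -D i (∑ a, S j a * algebraMap ℝ A (η a k)) + ∑ a, S j a * connCoeff D x i k a := by
  have h1 := deriv_minkowskiForm (D i) (vecDeriv (D j) N) (vecDeriv (D k) x)
  have h2 : minkowskiForm (vecDeriv (D j) N) (vecDeriv (D i) (vecDeriv (D k) x)) =
      -∑ a, S j a * connCoeff D x i k a := by
    rw [h.weingarten_form]
    simp only [minkowskiForm_comm (vecDeriv (D _) x), connCoeff]
  rw [h.weingarten_metric, h2, map_neg] at h1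
  linear_combination -h1

/-- The Codazzi equation. -/
theorem codazzi (h : IsAdaptedFrame D x N η S) (i j k : Fin 4) :
    D i (∑ a, S j a * algebraMap ℝ A (η a k)) - D j (∑ a, S i a * algebraMap ℝ A (η a k))
      - ∑ a, S j a * connCoeff D x i k a + ∑ a, S i a * connCoeff D x j k a =
    ∑ n, (∑ o, algebraMap ℝ A (η n o) * (connCoeff D x i j o - connCoeff D x j i o)) *
      ∑ a, S n a * algebraMap ℝ A (η a k) := by
  -- The same flatness argument, applied to the coordinates of the normal instead of a frame vector.
  have h1 := minkowskiForm_sum_left Finset.univ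
    (fun n => ∑ o, algebraMap ℝ A (η n o) * (connCoeff D x i j o - connCoeff D x j i o))
    (fun n => vecDeriv (D n) N) (vecDeriv (D k) x)
  have h2 : (fun m => ∑ n, (∑ o, algebraMap ℝ A (η n o) *
      (connCoeff D x i j o - connCoeff D x j i o)) * vecDeriv (D n) N m) =
      fun m => vecDeriv (D i) (vecDeriv (D j) N) m - vecDeriv (D j) (vecDeriv (D i) N) m :=
    funext fun m => (h.torsion i j (N m)).symm
  rw [h2, minkowskiForm_sub_left] at h1
  simp only [h.weingarten_deriv, h.weingarten_metric, mul_neg, Finset.sum_neg_distrib] at h1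
  linear_combination -h1

end IsAdaptedFrame

end AdaptedFrame
end

/-! ### Pseudo-orthonormal frames and the Codazzi equations of the Jordan form. -/

noncomputable section

section JordanFrame

variable {A : Type*} [CommRing A] [Algebra ℝ A]

/-- The metric coefficients of a pseudo-orthonormal frame. -/
def pseudoMetric (σ : ℝ) : Fin 4 → Fin 4 → ℝ :=
  ![![0, σ, 0, 0], ![σ, 0, 0, 0], ![0, 0, 1, 0], ![0, 0, 0, 1]]

/-- The shape operator with one Jordan block of size two, rows being the images of the frame. -/
def jordanShape (k₁ k₃ k₄ : A) : Fin 4 → Fin 4 → A :=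
  ![![k₁, 0, 0, 0], ![1, k₁, 0, 0], ![0, 0, k₃, 0], ![0, 0, 0, k₄]]

/-- The Laplace operator `-div ∇` expressed in a frame. -/
def frameLaplace (D : Fin 4 → Derivation ℝ A A) (x : Fin 5 → A) (η : Fin 4 → Fin 4 → ℝ)
    (f : A) : A :=
  -∑ i, ∑ j, algebraMap ℝ A (η i j) *
    (D i (D j f) - ∑ k, (∑ l, algebraMap ℝ A (η k l) * connCoeff D x i j l) * D k f)

theorem eq_zero_of_two_mul {z : A} (h : 2 * z = 0) : z = 0 := by
  have h2 : algebraMap ℝ A (1 / 2) * 2 = 1 := by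
    rw [← map_ofNat (algebraMap ℝ A) 2, ← map_mul]
    norm_num
  linear_combination algebraMap ℝ A (1 / 2) * h - z * h2

variable {D : Fin 4 → Derivation ℝ A A} {x N : Fin 5 → A} {σ : ℝ} {k₁ k₃ k₄ : A}

namespace IsAdaptedFrame

theorem connCoeff_self {η : Fin 4 → Fin 4 → ℝ} {S : Fin 4 → Fin 4 → A}
    (h : IsAdaptedFrame D x N η S) (i j : Fin 4) : connCoeff D x i j j = 0 :=
  eq_zero_of_two_mul (by linear_combination h.connCoeff_antisymm i j j)

theorem sigma_mul_self {S : Fin 4 → Fin 4 → A} (h : IsAdaptedFrame D x N (pseudoMetric σ) S) :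
    algebraMap ℝ A σ * algebraMap ℝ A σ = 1 := by
  have := h.sq 0 0
  simp only [Fin.sum_univ_four, pseudoMetric, Matrix.cons_val, if_true, mul_zero, zero_add,
    add_zero] at this
  rw [← map_mul, this, map_one]

theorem bracket {S : Fin 4 → Fin 4 → A} (h : IsAdaptedFrame D x N (pseudoMetric σ) S)
    (i j : Fin 4) (f : A) :
    D i (D j f) - D j (D i f) =
      algebraMap ℝ A σ * (connCoeff D x i j 1 - connCoeff D x j i 1) * D 0 f +
      algebraMap ℝ A σ * (connCoeff D x i j 0 - connCoeff D x j i 0) * D 1 f +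
      (connCoeff D x i j 2 - connCoeff D x j i 2) * D 2 f +
      (connCoeff D x i j 3 - connCoeff D x j i 3) * D 3 f := by
  have := h.torsion i j f
  simpa only [Fin.sum_univ_four, pseudoMetric, Matrix.cons_val, map_zero, map_one, zero_mul,
    one_mul, zero_add, add_zero] using this

/-- Parseval in the frame and normal. The last product consists of second fundamental forms, so
inserting this into `gauss` gives the Gauss equation in terms of curvatures and connection
coefficients only. -/
theorem deriv_form {S : Fin 4 → Fin 4 → A} (h : IsAdaptedFrame D x N (pseudoMetric σ) S)
    (i j k l : Fin 4) :
    minkowskiForm (vecDeriv (D i) (vecDeriv (D j) x)) (vecDeriv (D k) (vecDeriv (D l) x)) =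
      algebraMap ℝ A σ * connCoeff D x i j 1 * connCoeff D x k l 0 +
      algebraMap ℝ A σ * connCoeff D x i j 0 * connCoeff D x k l 1 +
      connCoeff D x i j 2 * connCoeff D x k l 2 + connCoeff D x i j 3 * connCoeff D x k l 3 +
      (∑ a, S i a * algebraMap ℝ A (pseudoMetric σ a j)) *
        ∑ a, S k a * algebraMap ℝ A (pseudoMetric σ a l) := by
  rw [h.parseval, h.second_form, h.second_form]
  congr 1
  simp only [Fin.sum_univ_four, pseudoMetric, Matrix.cons_val, map_zero, map_one, zero_mul,
    one_mul, zero_add, add_zero]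
  rfl

/-- The components of the Codazzi equation for a shape operator with a Jordan block. -/
structure JordanCodazzi (D : Fin 4 → Derivation ℝ A A) (x : Fin 5 → A) (s k₁ k₃ k₄ : A) :
    Prop where
  d0k1 : D 0 k₁ = 0
  g002 : (k₁ - k₃) * connCoeff D x 0 0 2 = 0
  g003 : (k₁ - k₄) * connCoeff D x 0 0 3 = 0
  d1k1 : D 1 k₁ = 2 * s * connCoeff D x 0 0 1
  g012 : s * D 2 k₁ = (k₁ - k₃) * connCoeff D x 0 1 2 + connCoeff D x 0 0 2
  g102 : s * D 2 k₁ = (k₁ - k₃) * connCoeff D x 1 0 2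
  g013 : s * D 3 k₁ = (k₁ - k₄) * connCoeff D x 0 1 3 + connCoeff D x 0 0 3
  g103 : s * D 3 k₁ = (k₁ - k₄) * connCoeff D x 1 0 3
  d0k3 : D 0 k₃ = (k₁ - k₃) * connCoeff D x 2 0 2
  d0k4 : D 0 k₄ = (k₁ - k₄) * connCoeff D x 3 0 3
  g023 : (k₃ - k₄) * connCoeff D x 0 2 3 = (k₁ - k₄) * connCoeff D x 2 0 3
  g203 : (k₁ - k₄) * connCoeff D x 2 0 3 = (k₁ - k₃) * connCoeff D x 3 0 2
  g201 : 2 * connCoeff D x 2 0 1 = connCoeff D x 1 0 2 + (k₁ - k₃) * connCoeff D x 1 1 2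
  g301 : 2 * connCoeff D x 3 0 1 = connCoeff D x 1 0 3 + (k₁ - k₄) * connCoeff D x 1 1 3
  d1k3 : D 1 k₃ = connCoeff D x 2 0 2 + (k₁ - k₃) * connCoeff D x 2 1 2
  d1k4 : D 1 k₄ = connCoeff D x 3 0 3 + (k₁ - k₄) * connCoeff D x 3 1 3
  g123 : (k₃ - k₄) * connCoeff D x 1 2 3 = connCoeff D x 2 0 3 + (k₁ - k₄) * connCoeff D x 2 1 3
  g213 : connCoeff D x 2 0 3 + (k₁ - k₄) * connCoeff D x 2 1 3 =
    connCoeff D x 3 0 2 + (k₁ - k₃) * connCoeff D x 3 1 2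
  d3k3 : D 3 k₃ = (k₃ - k₄) * connCoeff D x 2 2 3
  d2k4 : D 2 k₄ = (k₃ - k₄) * connCoeff D x 3 2 3

theorem jordanCodazzi (h : IsAdaptedFrame D x N (pseudoMetric σ) (jordanShape k₁ k₃ k₄)) :
    JordanCodazzi D x (algebraMap ℝ A σ) k₁ k₃ k₄ := by
  have hs := h.sigma_mul_self
  have C := h.codazzi
  have a10 := fun i => h.connCoeff_antisymm i 1 0
  have a20 := fun i => h.connCoeff_antisymm i 2 0
  have a30 := fun i => h.connCoeff_antisymm i 3 0
  have a21 := fun i => h.connCoeff_antisymm i 2 1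
  have a31 := fun i => h.connCoeff_antisymm i 3 1
  have a32 := fun i => h.connCoeff_antisymm i 3 2
  have C010 := C 0 1 0
  have C011 := C 0 1 1
  have C020 := C 0 2 0
  have C021 := C 0 2 1
  have C022 := C 0 2 2
  have C023 := C 0 2 3
  have C030 := C 0 3 0
  have C031 := C 0 3 1
  have C033 := C 0 3 3
  have C120 := C 1 2 0
  have C121 := C 1 2 1
  have C122 := C 1 2 2
  have C123 := C 1 2 3
  have C130 := C 1 3 0
  have C131 := C 1 3 1
  have C133 := C 1 3 3
  have C230 := C 2 3 0
  have C231 := C 2 3 1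
  have C232 := C 2 3 2
  have C233 := C 2 3 3
  clear C
  simp only [Fin.sum_univ_four, jordanShape, pseudoMetric, Matrix.cons_val, map_zero, mul_zero,
    zero_mul, add_zero, zero_add, map_one, mul_one, one_mul, sub_zero, Derivation.leibniz,
    Derivation.map_algebraMap, smul_eq_mul, h.connCoeff_self, a10, a20, a30, a21, a31, a32]
    at C010 C011 C020 C021 C022 C023 C030 C031 C033 C120 C121 C122 C123 C130
      C131 C133 C230 C231 C232 C233
  set s := algebraMap ℝ A σ with hsdef
  set Γ := connCoeff D x with hΓ
  -- Each equation below comes from one Codazzi component, up to a factor `±1` or `±s`, with `d0k1`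
  -- obtained first. Raising lightlike indices creates factors `s²`, which the multiples of `hs : s
  -- * s = 1` remove.
  have d0k1 : D 0 k₁ = 0 := by
    linear_combination s * C010 + (-D 0 k₁ - s * k₁ * Γ 0 0 1) * hs
  constructor
  · exact d0k1
  · linear_combination C020 - k₁ * Γ 0 0 2 * hs
  · linear_combination C030 - k₁ * Γ 0 0 3 * hs
  · linear_combination -s * C011 + (-D 1 k₁ + s * k₁ * Γ 1 0 1 + s * Γ 0 0 1) * hs
  · linear_combination -C021 + (k₁ * Γ 0 1 2 + k₁ * Γ 2 0 1 + Γ 0 0 2) * hs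
  · linear_combination -C120 + (k₁ * Γ 1 0 2 - k₁ * Γ 2 0 1) * hs
  · linear_combination -C031 + (k₁ * Γ 0 1 3 + k₁ * Γ 3 0 1 + Γ 0 0 3) * hs
  · linear_combination -C130 + (k₁ * Γ 1 0 3 - k₁ * Γ 3 0 1) * hs
  · linear_combination C022
  · linear_combination C033
  · linear_combination C023
  · linear_combination C230 + (k₁ * Γ 3 0 2 - k₁ * Γ 2 0 3) * hs
  · linear_combination -C121 + (k₁ * Γ 1 1 2 - Γ 2 0 1 + Γ 1 0 2) * hs
  · linear_combination -C131 + (k₁ * Γ 1 1 3 - Γ 3 0 1 + Γ 1 0 3) * hs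
  · linear_combination C122
  · linear_combination C133
  · linear_combination C123
  · linear_combination C231 + (k₁ * Γ 3 1 2 - k₁ * Γ 2 1 3 - Γ 2 0 3 + Γ 3 0 2) * hs
  · linear_combination -C232
  · linear_combination C233

end IsAdaptedFrame
end JordanFrame
end

/-! ### The Laplacian in a frame and the two parts of the biharmonic equation. -/

noncomputable section

section FrameLaplace

variable {A : Type*} [CommRing A] [Algebra ℝ A]
  {D : Fin 4 → Derivation ℝ A A} {x N : Fin 5 → A} {σ : ℝ} {k₁ k₃ k₄ : A}

theorem frameLaplace_pseudoMetric (D : Fin 4 → Derivation ℝ A A) (x : Fin 5 → A) (σ : ℝ) (f : A) :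
    frameLaplace D x (pseudoMetric σ) f =
      -(algebraMap ℝ A σ * (D 0 (D 1 f) - (algebraMap ℝ A σ * connCoeff D x 0 1 1 * D 0 f +
          algebraMap ℝ A σ * connCoeff D x 0 1 0 * D 1 f + connCoeff D x 0 1 2 * D 2 f +
          connCoeff D x 0 1 3 * D 3 f)) +
        algebraMap ℝ A σ * (D 1 (D 0 f) - (algebraMap ℝ A σ * connCoeff D x 1 0 1 * D 0 f +
          algebraMap ℝ A σ * connCoeff D x 1 0 0 * D 1 f + connCoeff D x 1 0 2 * D 2 f +
          connCoeff D x 1 0 3 * D 3 f)) +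
        (D 2 (D 2 f) - (algebraMap ℝ A σ * connCoeff D x 2 2 1 * D 0 f +
          algebraMap ℝ A σ * connCoeff D x 2 2 0 * D 1 f + connCoeff D x 2 2 2 * D 2 f +
          connCoeff D x 2 2 3 * D 3 f)) +
        (D 3 (D 3 f) - (algebraMap ℝ A σ * connCoeff D x 3 3 1 * D 0 f +
          algebraMap ℝ A σ * connCoeff D x 3 3 0 * D 1 f + connCoeff D x 3 3 2 * D 2 f +
          connCoeff D x 3 3 3 * D 3 f))) := by
  simp only [frameLaplace, Fin.sum_univ_four, pseudoMetric, Matrix.cons_val, map_zero, map_one,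
    zero_mul, one_mul, zero_add, add_zero]

namespace IsAdaptedFrame

/-- The Laplacian of the position vector is `-s₁ N`. -/
theorem frameLaplace_position {η : Fin 4 → Fin 4 → ℝ} {S : Fin 4 → Fin 4 → A}
    (h : IsAdaptedFrame D x N η S) (m : Fin 5) :
    frameLaplace D x η (x m) = -((∑ i, S i i) * N m) := by
  -- The Hessian of the position vector has no tangential part: it is the second fundamental form
  -- times `N`.
  have h1 : ∀ i j, D i (D j (x m)) -
      ∑ k, (∑ l, algebraMap ℝ A (η k l) * connCoeff D x i j l) * D k (x m) =
      (∑ k, S i k * algebraMap ℝ A (η k j)) * N m := by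
    intro i j
    have := h.expand (vecDeriv (D i) (vecDeriv (D j) x)) m
    rw [h.second_form] at this
    exact sub_eq_of_eq_add' this
  have h2 : ∀ i, ∑ j, algebraMap ℝ A (η i j) * ∑ k, S i k * algebraMap ℝ A (η k j) = S i i := by
    intro i
    have h3 : ∀ k, ∑ j, algebraMap ℝ A (η i j) * (S i k * algebraMap ℝ A (η k j)) =
        if k = i then S i k else 0 := by
      intro k
      have h4 : ∑ j, algebraMap ℝ A (η k j) * algebraMap ℝ A (η j i) = if k = i then 1 else 0 := by
        simp only [← map_mul, ← map_sum, h.sq]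
        split_ifs <;> simp
      calc _ = S i k * ∑ j, algebraMap ℝ A (η k j) * algebraMap ℝ A (η j i) := by
            rw [Finset.mul_sum]
            refine Finset.sum_congr rfl fun j _ => ?_
            rw [h.symm i j]; ring
        _ = _ := by rw [h4]; split_ifs <;> simp
    simp only [Finset.mul_sum]
    rw [Finset.sum_comm]
    simp only [h3]
    simp
  simp only [frameLaplace, h1, ← mul_assoc]
  simp only [← Finset.sum_mul, h2]

/-- The product rule for `Δ`, with its cross term in `∇f`, tested against `W`. Taking `W` to be `N`
or a frame vector isolates the normal or a tangential part. -/
theorem minkowskiForm_frameLaplace_mul (D : Fin 4 → Derivation ℝ A A) (x N : Fin 5 → A) (σ : ℝ)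
    (f : A) (W : Fin 5 → A) :
    minkowskiForm (fun m => frameLaplace D x (pseudoMetric σ) (f * N m)) W =
      minkowskiForm N W * frameLaplace D x (pseudoMetric σ) f
      - 2 * (algebraMap ℝ A σ * (D 0 f * minkowskiForm (vecDeriv (D 1) N) W +
          D 1 f * minkowskiForm (vecDeriv (D 0) N) W) +
        D 2 f * minkowskiForm (vecDeriv (D 2) N) W + D 3 f * minkowskiForm (vecDeriv (D 3) N) W)
      + f * minkowskiForm (fun m => frameLaplace D x (pseudoMetric σ) (N m)) W := by
  simp only [frameLaplace_pseudoMetric, Derivation.leibniz, map_add, smul_eq_mul, minkowskiForm,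
    vecDeriv]
  ring

theorem minkowskiForm_frameLaplace (D : Fin 4 → Derivation ℝ A A) (x N : Fin 5 → A)
    (η : Fin 4 → Fin 4 → ℝ) (W : Fin 5 → A) :
    minkowskiForm (fun m => frameLaplace D x η (N m)) W =
      -∑ i, ∑ j, algebraMap ℝ A (η i j) * (minkowskiForm (vecDeriv (D i) (vecDeriv (D j) N)) W -
        ∑ k, (∑ l, algebraMap ℝ A (η k l) * connCoeff D x i j l) *
          minkowskiForm (vecDeriv (D k) N) W) := by
  simp only [frameLaplace]
  rw [minkowskiForm_neg_left]
  congr 1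
  have h1 : ∀ i, (minkowskiForm (fun m => ∑ j, algebraMap ℝ A (η i j) * (D i (D j (N m)) -
      ∑ k, (∑ l, algebraMap ℝ A (η k l) * connCoeff D x i j l) * D k (N m))) W) =
      ∑ j, algebraMap ℝ A (η i j) * (minkowskiForm (vecDeriv (D i) (vecDeriv (D j) N)) W -
        ∑ k, (∑ l, algebraMap ℝ A (η k l) * connCoeff D x i j l) *
          minkowskiForm (vecDeriv (D k) N) W) := by
    intro i
    refine (minkowskiForm_sum_left Finset.univ (fun j => algebraMap ℝ A (η i j)) (fun j m =>
      D i (D j (N m)) - ∑ k, (∑ l, algebraMap ℝ A (η k l) * connCoeff D x i j l) * D k (N m))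
      W).trans (Finset.sum_congr rfl fun j _ => ?_)
    rw [minkowskiForm_sub_left]
    congr 2
    exact minkowskiForm_sum_left Finset.univ _ (fun k => vecDeriv (D k) N) W
  rw [← Finset.sum_congr rfl fun i _ => h1 i]
  simpa only [one_mul] using minkowskiForm_sum_left Finset.univ (fun _ : Fin 4 => (1 : A))
    (fun i m => ∑ j, algebraMap ℝ A (η i j) * (D i (D j (N m)) -
      ∑ k, (∑ l, algebraMap ℝ A (η k l) * connCoeff D x i j l) * D k (N m))) W

/-- The normal part of the biharmonic equation. -/
theorem biharmonic_normal (h : IsAdaptedFrame D x N (pseudoMetric σ) (jordanShape k₁ k₃ k₄))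
    {f : A} (hf : ∀ m, frameLaplace D x (pseudoMetric σ) (f * N m) = 0) :
    frameLaplace D x (pseudoMetric σ) f + f * (2 * k₁ ^ 2 + k₃ ^ 2 + k₄ ^ 2) = 0 := by
  have h0 := minkowskiForm_frameLaplace_mul D x N σ f N
  have h1 : ∀ i, minkowskiForm (vecDeriv (D i) N) N = 0 := by
    intro i
    rw [h.weingarten_form]
    simp only [minkowskiForm_comm _ N, h.normal, mul_zero, Finset.sum_const_zero, neg_zero]
  -- Differentiating `⟨DⱼN, N⟩ = 0` gives `-⟨DᵢN, DⱼN⟩`, whose trace over the frame is `-tr S²`.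
  have h2 : ∀ i j, minkowskiForm (vecDeriv (D i) (vecDeriv (D j) N)) N =
      -∑ a, jordanShape k₁ k₃ k₄ j a * ∑ b, jordanShape k₁ k₃ k₄ i b *
        algebraMap ℝ A (pseudoMetric σ b a) := by
    intro i j
    have h3 := deriv_minkowskiForm (D i) (vecDeriv (D j) N) N
    rw [h1, map_zero, h.weingarten_form j] at h3
    simp only [minkowskiForm_comm (vecDeriv (D _) x), h.weingarten_metric, mul_neg,
      Finset.sum_neg_distrib, neg_neg] at h3
    linear_combination -h3
  have hs := h.sigma_mul_self
  have hN := minkowskiForm_frameLaplace D x N (pseudoMetric σ) N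
  simp only [hf, minkowskiForm_zero_left, h.unit, h1, mul_zero, add_zero, sub_zero, one_mul] at h0
  rw [hN] at h0
  generalize frameLaplace D x (pseudoMetric σ) f = L at h0 ⊢
  simp only [h1, h2, Fin.sum_univ_four, jordanShape, pseudoMetric, Matrix.cons_val, map_zero,
    map_one, zero_mul, one_mul, mul_zero, mul_one, zero_add, add_zero] at h0
  linear_combination -h0 - f * 2 * k₁ ^ 2 * hs

/-- The tangential part of the biharmonic equation, `S ∇s₁ = -(s₁ / 2) ∇s₁`. -/
theorem biharmonic_tangential
    (h : IsAdaptedFrame D x N (pseudoMetric σ) (jordanShape k₁ k₃ k₄))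
    (hf : ∀ m, frameLaplace D x (pseudoMetric σ) ((2 * k₁ + k₃ + k₄) * N m) = 0) :
    (2 * k₁ + k₃ + k₄ + 2 * k₁) * D 0 (2 * k₁ + k₃ + k₄) = 0 ∧
    (2 * k₁ + k₃ + k₄ + 2 * k₁) * D 1 (2 * k₁ + k₃ + k₄) + 2 * D 0 (2 * k₁ + k₃ + k₄) = 0 ∧
    (2 * k₁ + k₃ + k₄ + 2 * k₃) * D 2 (2 * k₁ + k₃ + k₄) = 0 ∧
    (2 * k₁ + k₃ + k₄ + 2 * k₄) * D 3 (2 * k₁ + k₃ + k₄) = 0 := by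
  have hs := h.sigma_mul_self
  have hC := h.jordanCodazzi
  have h0 := fun k => minkowskiForm_frameLaplace_mul D x N σ (2 * k₁ + k₃ + k₄) (vecDeriv (D k) x)
  have a10 := fun i => h.connCoeff_antisymm i 1 0
  have a20 := fun i => h.connCoeff_antisymm i 2 0
  have a30 := fun i => h.connCoeff_antisymm i 3 0
  have a21 := fun i => h.connCoeff_antisymm i 2 1
  have a31 := fun i => h.connCoeff_antisymm i 3 1
  have a32 := fun i => h.connCoeff_antisymm i 3 2
  simp only [hf, minkowskiForm_zero_left, h.normal, minkowskiForm_frameLaplace, h.weingarten_deriv,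
    h.weingarten_metric] at h0
  obtain ⟨d0k1, g002, g003, d1k1, g012, g102, g013, g103, d0k3, d0k4, g023, g203, g201, g301,
    d1k3, d1k4, g123, g213, d3k3, d2k4⟩ := hC
  have q0 := h0 0
  have q1 := h0 1
  have q2 := h0 2
  have q3 := h0 3
  clear h0
  simp only [Fin.sum_univ_four, jordanShape, pseudoMetric, Matrix.cons_val, map_zero, mul_zero,
    zero_mul, add_zero, zero_add, map_one, mul_one, one_mul, Derivation.leibniz, Derivation.map_one_eq_zero,
    Derivation.map_algebraMap, smul_eq_mul, h.connCoeff_self, a10, a20, a30, a21, a31, a32]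
    at q0 q1 q2 q3
  have hD : ∀ i, D i (2 * k₁ + k₃ + k₄) = 2 * D i k₁ + D i k₃ + D i k₄ := by
    intro i
    rw [map_add, map_add, Derivation.leibniz, ← map_ofNat (algebraMap ℝ A) 2,
      Derivation.map_algebraMap]
    simp
  simp only [hD] at q0 q1 q2 q3 ⊢
  set s := algebraMap ℝ A σ
  set Γ := connCoeff D x
  -- The sums of Codazzi equations used here are their traces; they identify the tangential part of
  -- `ΔN` with `∇s₁`.
  refine ⟨?_, ?_, ?_, ?_⟩
  · linear_combination -q0 + (2 * k₁ + k₃ + k₄) * (d0k1 + d0k3 + d0k4) +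
      (-2 * k₁ * (2 * D 0 k₁ + D 0 k₃ + D 0 k₄) - (2 * k₁ + k₃ + k₄) * (D 0 k₁ +
        s * k₁ * Γ 0 0 1 + k₁ * Γ 2 0 2 + k₁ * Γ 3 0 3)) * hs
  · linear_combination -q1 + (2 * k₁ + k₃ + k₄) * (d1k1 + d1k3 + d1k4) +
      (-2 * (2 * D 0 k₁ + D 0 k₃ + D 0 k₄ + k₁ * (2 * D 1 k₁ + D 1 k₃ + D 1 k₄)) -
        (2 * k₁ + k₃ + k₄) * (s * Γ 0 0 1 + D 1 k₁ - s * k₁ * Γ 1 0 1 + k₁ * Γ 2 1 2 +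
        Γ 2 0 2 + k₁ * Γ 3 1 3 + Γ 3 0 3)) * hs
  · linear_combination -q2 + (2 * k₁ + k₃ + k₄) * (d2k4 + s * (g012 + g102) - 2 * D 2 k₁ * hs)
  · linear_combination -q3 + (2 * k₁ + k₃ + k₄) * (d3k3 + s * (g013 + g103) - 2 * D 3 k₁ * hs)

end IsAdaptedFrame
end FrameLaplace
end

/-! ### Consequences of `∇s₁` being an eigenvector: the Jordan and the simple case. -/

noncomputable section

section EigenvalueCases

variable {A : Type*} [CommRing A] [Algebra ℝ A]
  {D : Fin 4 → Derivation ℝ A A} {x N : Fin 5 → A} {σ : ℝ} {k₁ k₃ k₄ : A}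

namespace IsAdaptedFrame

/-- The gradient of `s₁` cannot be lightlike and proportional to the eigenvector of the Jordan
block. -/
theorem eq_zero_of_jordan_eigenvalue [IsReduced A]
    (h : IsAdaptedFrame D x N (pseudoMetric σ) (jordanShape k₁ k₃ k₄))
    (h₁₃ : ∀ z, (k₁ - k₃) * z = 0 → z = 0) (h₁₄ : ∀ z, (k₁ - k₄) * z = 0 → z = 0)
    (h₃₄ : ∀ z, (k₃ - k₄) * z = 0 → z = 0) (hk : ∀ z, k₁ * z = 0 → z = 0)
    (hd : ∀ z, D 1 k₁ * z = 0 → z = 0) (htr : k₃ + k₄ = -4 * k₁)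
    (h2 : D 2 k₁ = 0) (h3 : D 3 k₁ = 0) : k₁ = 0 := by
  have hs := h.sigma_mul_self
  have hσ : ∀ z, algebraMap ℝ A σ * z = 0 → z = 0 := fun z hz => by
    linear_combination algebraMap ℝ A σ * hz - z * hs
  obtain ⟨d0k1, g002, g003, d1k1, g012, g102, g013, g103, d0k3, d0k4, g023, g203, g201, g301,
    d1k3, d1k4, g123, g213, d3k3, d2k4⟩ := h.jordanCodazzi
  have a10 := fun i => h.connCoeff_antisymm i 1 0
  have a20 := fun i => h.connCoeff_antisymm i 2 0
  have a30 := fun i => h.connCoeff_antisymm i 3 0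
  have a21 := fun i => h.connCoeff_antisymm i 2 1
  have a31 := fun i => h.connCoeff_antisymm i 3 1
  have a32 := fun i => h.connCoeff_antisymm i 3 2
  have z002 := h₁₃ _ g002
  have z003 := h₁₄ _ g003
  rw [h2, mul_zero] at g012 g102
  rw [h3, mul_zero] at g013 g103
  rw [z002, add_zero] at g012
  rw [z003, add_zero] at g013
  have z012 := h₁₃ _ g012.symm
  have z102 := h₁₃ _ g102.symm
  have z013 := h₁₄ _ g013.symm
  have z103 := h₁₄ _ g103.symm
  -- Only `D 1 k₁` can be nonzero, so the bracket applied to `k₁` sees just the `e 1` component of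
  -- `[e 2, e 3]`, which must vanish.
  have b23 := h.bracket 2 3 k₁
  simp only [h2, h3, d0k1, map_zero, mul_zero, zero_add, add_zero, sub_zero, a20, a30] at b23
  have e203 : connCoeff D x 3 0 2 - connCoeff D x 2 0 3 = 0 :=
    hd _ (hσ _ (by linear_combination -b23))
  have z203 : connCoeff D x 2 0 3 = 0 :=
    h₃₄ _ (by linear_combination g203 + (k₁ - k₃) * e203)
  have z302 : connCoeff D x 3 0 2 = 0 := by linear_combination e203 + z203
  have z023 : connCoeff D x 0 2 3 = 0 := h₃₄ _ (by rw [g023, z203, mul_zero])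
  have G : ∀ i j k l, _ := h.gauss
  simp only [h.deriv_form] at G
  -- The first two components describe how `Γ 2 0 2` and `Γ 3 0 3` vary along `e 0`; the last two do
  -- this for `Γ 2 1 2` and `Γ 3 1 3`.
  have G1 := G 0 2 0 2
  have G2 := G 0 3 0 3
  have G3 := G 0 2 1 2
  have G4 := G 0 3 1 3
  clear G
  simp only [Fin.sum_univ_four, jordanShape, pseudoMetric, Matrix.cons_val, map_zero, mul_zero,
    zero_mul, add_zero, zero_add, map_one, mul_one, one_mul, sub_zero, h.connCoeff_self, a10, a20,
    a30, a21, a31, a32, z002, z003, z012, z102, z013, z103, z203, z302, z023, neg_zero, sub_self,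
    zero_sub, mul_neg, neg_mul, neg_neg] at G1 G2 G3 G4
  have htr0 := congrArg (D 0) htr
  have hD4 : ∀ i, D i (-4 * k₁) = -4 * D i k₁ := by
    intro i
    rw [Derivation.leibniz, map_neg, ← map_ofNat (algebraMap ℝ A) 4, Derivation.map_algebraMap]
    simp
  rw [map_add, hD4, d0k1, d0k3, d0k4, mul_zero] at htr0
  have htr00 := congrArg (D 0) htr0
  simp only [map_add, map_sub, map_zero, Derivation.leibniz, smul_eq_mul, d0k1, d0k3, d0k4]
    at htr00
  have b3 := h.bracket 0 1 k₃
  have b4 := h.bracket 0 1 k₄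
  simp only [a10, h.connCoeff_self, z012, z102, z013, z103, sub_self, zero_mul, add_zero] at b3 b4
  set s := algebraMap ℝ A σ
  set Γ := connCoeff D x
  -- Write `α = Γ 2 0 2`, `β = Γ 3 0 3`. The trace relation differentiated once along `e 0` says
  -- `(k₁ - k₃)α + (k₁ - k₄)β = 0`; differentiated twice, it gives the same relation for `α²`, `β²`.
  -- Together they give `6k₁α² = 0`.
  have hq : (k₁ - k₃) * Γ 2 0 2 ^ 2 + (k₁ - k₄) * Γ 3 0 3 ^ 2 = 0 := eq_zero_of_two_mul (by
    linear_combination -htr00 + (k₁ - k₃) * G1 + (k₁ - k₄) * G2 + s * Γ 0 0 1 * htr0)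
  have z202 : Γ 2 0 2 = 0 := by
    have e1 : Γ 2 0 2 ^ 2 - Γ 2 0 2 * Γ 3 0 3 = 0 :=
      h₁₃ _ (by linear_combination hq - Γ 3 0 3 * htr0)
    have e2 : k₁ * (2 * (3 * Γ 2 0 2 ^ 2)) = 0 := by
      linear_combination Γ 2 0 2 * htr0 + (k₁ - k₄) * e1 + Γ 2 0 2 ^ 2 * htr
    have e3 := eq_zero_of_two_mul (hk _ e2)
    have h13 : algebraMap ℝ A (1 / 3) * 3 = 1 := by
      rw [← map_ofNat (algebraMap ℝ A) 3, ← map_mul]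
      norm_num
    have e4 : Γ 2 0 2 ^ 2 = 0 := by
      linear_combination algebraMap ℝ A (1 / 3) * e3 - Γ 2 0 2 ^ 2 * h13
    exact pow_eq_zero_iff two_ne_zero |>.1 e4
  have z303 : Γ 3 0 3 = 0 := h₁₄ _ (by linear_combination htr0 - (k₁ - k₃) * z202)
  rw [z202, mul_zero] at d0k3
  rw [z303, mul_zero] at d0k4
  rw [z202, zero_add] at d1k3
  rw [z303, zero_add] at d1k4
  simp only [d0k3, d0k4, d1k3, d1k4, d0k1, map_zero, map_sub, Derivation.leibniz, smul_eq_mul,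
    mul_zero, sub_zero, zero_add, add_zero] at b3 b4
  simp only [z202, z303, zero_mul, neg_zero] at G3 G4
  -- Evaluating `[e 0, e 1]` on `k₃` and comparing with the Gauss equation leaves only the curvature
  -- term `σ k₁ k₃`, up to the factor `k₁ - k₃`.
  have z3 : k₃ = 0 := hk _ (hσ _ (h₁₃ _ (by linear_combination (k₁ - k₃) * G3 - b3)))
  have z4 : k₄ = 0 := hk _ (hσ _ (h₁₄ _ (by linear_combination (k₁ - k₄) * G4 - b4)))
  exact eq_zero_of_two_mul (eq_zero_of_two_mul (by linear_combination htr - z3 - z4))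

/-- If the gradient of `s₁` is proportional to a spacelike eigenvector `e₂` with eigenvalue `k₃`,
then the principal curvatures satisfy a closed system of differential equations along `e₂`. -/
theorem exists_system_of_simple_eigenvalue
    (h : IsAdaptedFrame D x N (pseudoMetric σ) (jordanShape k₁ k₃ k₄))
    (h₁₃ : ∀ z, (k₁ - k₃) * z = 0 → z = 0) (h₁₄ : ∀ z, (k₁ - k₄) * z = 0 → z = 0)
    (h₃₄ : ∀ z, (k₃ - k₄) * z = 0 → z = 0)
    (hd : ∀ z, D 2 k₃ * z = 0 → z = 0) (htr : 3 * k₃ = -2 * k₁ - k₄)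
    (h0 : D 0 k₃ = 0) (h1 : D 1 k₃ = 0) (h3 : D 3 k₃ = 0)
    (hL : frameLaplace D x (pseudoMetric σ) k₃ + k₃ * (2 * k₁ ^ 2 + k₃ ^ 2 + k₄ ^ 2) = 0) :
    ∃ p q : A, D 2 k₁ = (k₁ - k₃) * p ∧ D 2 k₄ = (k₄ - k₃) * q ∧ D 2 p = p ^ 2 + k₁ * k₃ ∧
      D 2 q = q ^ 2 + k₃ * k₄ ∧
      D 2 (D 2 k₃) = (2 * p + q) * D 2 k₃ + k₃ * (2 * k₁ ^ 2 + k₃ ^ 2 + k₄ ^ 2) := by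
  have hs := h.sigma_mul_self
  obtain ⟨d0k1, g002, g003, d1k1, g012, g102, g013, g103, d0k3, d0k4, g023, g203, g201, g301,
    d1k3, d1k4, g123, g213, d3k3, d2k4⟩ := h.jordanCodazzi
  have a10 := fun i => h.connCoeff_antisymm i 1 0
  have a20 := fun i => h.connCoeff_antisymm i 2 0
  have a30 := fun i => h.connCoeff_antisymm i 3 0
  have a21 := fun i => h.connCoeff_antisymm i 2 1
  have a31 := fun i => h.connCoeff_antisymm i 3 1
  have a32 := fun i => h.connCoeff_antisymm i 3 2
  have z002 := h₁₃ _ g002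
  have z003 := h₁₄ _ g003
  have e04 : D 0 k₄ = 0 := by
    have hk4 : k₄ = -2 * k₁ - 3 * k₃ := by linear_combination htr
    rw [hk4, map_sub, Derivation.leibniz, Derivation.leibniz, map_neg,
      ← map_ofNat (algebraMap ℝ A) 2, ← map_ofNat (algebraMap ℝ A) 3,
      Derivation.map_algebraMap, Derivation.map_algebraMap, h0, d0k1]
    simp
  rw [h0] at d0k3
  rw [e04] at d0k4
  rw [h3] at d3k3
  have z202 := h₁₃ _ d0k3.symm
  have z303 := h₁₄ _ d0k4.symm
  have z223 := h₃₄ _ d3k3.symm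
  rw [h1, z202, zero_add] at d1k3
  have z212 := h₁₃ _ d1k3.symm
  rw [z002, add_zero] at g012
  have e012 : connCoeff D x 0 1 2 = connCoeff D x 1 0 2 :=
    sub_eq_zero.1 (h₁₃ _ (by linear_combination g102 - g012))
  -- Since `k₃` varies only along `e 2`, the brackets `[e 0, e 3]` and `[e 1, e 3]` have no `e 2`
  -- component.
  have b03 := h.bracket 0 3 k₃
  have b13 := h.bracket 1 3 k₃
  simp only [h0, h1, h3, map_zero, mul_zero, zero_add, add_zero, sub_zero, a32] at b03 b13
  have e032 : connCoeff D x 0 2 3 + connCoeff D x 3 0 2 = 0 :=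
    hd _ (by linear_combination b03)
  have e132 : connCoeff D x 1 2 3 + connCoeff D x 3 1 2 = 0 :=
    hd _ (by linear_combination b13)
  have z023 : connCoeff D x 0 2 3 = 0 :=
    h₁₄ _ (by linear_combination g023 + g203 + (k₁ - k₃) * e032)
  have z302 : connCoeff D x 3 0 2 = 0 := by linear_combination e032 - z023
  have z203 : connCoeff D x 2 0 3 = 0 := h₁₄ _ (by rw [g203, z302, mul_zero])
  have z123 : connCoeff D x 1 2 3 = 0 :=
    h₁₄ _ (by linear_combination g123 + g213 + (k₁ - k₃) * e132 + z302)
  have z312 : connCoeff D x 3 1 2 = 0 := by linear_combination e132 - z123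
  have z213 : connCoeff D x 2 1 3 = 0 := h₁₄ _ (by
    linear_combination g213 - z203 + z302 + (k₁ - k₃) * z312)
  have G : ∀ i j k l, _ := h.gauss
  simp only [h.deriv_form] at G
  have G1 := G 0 2 2 1
  have G2 := G 3 2 2 3
  clear G
  rw [frameLaplace_pseudoMetric] at hL
  simp only [Fin.sum_univ_four, jordanShape, pseudoMetric, Matrix.cons_val, map_zero, mul_zero,
    zero_mul, add_zero, zero_add, map_one, mul_one, one_mul, sub_zero, h.connCoeff_self, a10, a20,
    a30, a21, a31, a32, z002, z202, z303, z223, z212, z302, z203, z123, z312, z213, z023,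
    neg_zero, sub_self, zero_sub, mul_neg, neg_mul, neg_neg, map_neg, h0, h1, h3, e012]
    at G1 G2 hL
  set s := algebraMap ℝ A σ with hsdef
  set Γ := connCoeff D x
  -- The witnesses are read off from the Codazzi equations for `D 2 k₁` and `D 2 k₄`. Their Riccati
  -- equations are the Gauss components `G1`, `G2`; the last equation is `hL` with every derivative
  -- of `k₃` except those along `e 2` removed.
  refine ⟨s * Γ 1 0 2, -Γ 3 2 3, ?_, ?_, ?_, ?_, ?_⟩
  · linear_combination s * g102 - D 2 k₁ * hs
  · linear_combination d2k4
  · rw [Derivation.leibniz, hsdef, Derivation.map_algebraMap, ← hsdef]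
    simp only [smul_eq_mul, mul_zero, add_zero]
    linear_combination s * G1 + k₁ * k₃ * hs
  · rw [map_neg]
    linear_combination G2
  · linear_combination -hL

end IsAdaptedFrame
end EigenvalueCases
end

/-! ### Elimination of the connection coefficients from the differential system. -/

noncomputable section

section Elimination

/-! The polynomials `elimL`, `elimK`, `elimQuad`, `elimLin`, `elimConst` are the coefficients that
arise when the differential system for the principal curvatures is differentiated twice and
`X Y` is eliminated; `elimResultant` is the resulting condition on the ratio of the principal
curvatures. -/

variable {A : Type*} [CommRing A]

def elimL (a t : A) : A :=
  -(24 * a ^ 4 + 186 * a ^ 3 * t + 588 * a ^ 2 * t ^ 2 + 843 * a * t ^ 3 + 348 * t ^ 4)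

def elimK (a t : A) : A :=
  -(108 * a ^ 4 * t ^ 2 + 864 * a ^ 3 * t ^ 3 + 2997 * a ^ 2 * t ^ 4 + 5076 * a * t ^ 5 +
    3591 * t ^ 6)

def elimQuad (a t : A) : A :=
  56 * a ^ 5 + 552 * a ^ 4 * t + 2380 * a ^ 3 * t ^ 2 + 5948 * a ^ 2 * t ^ 3 + 8932 * a * t ^ 4 +
    6936 * t ^ 5

def elimLin (a t : A) : A :=
  2304 * a ^ 6 * t + 27216 * a ^ 5 * t ^ 2 + 144144 * a ^ 4 * t ^ 3 + 426726 * a ^ 3 * t ^ 4 +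
    721764 * a ^ 2 * t ^ 5 + 638613 * a * t ^ 6 + 211410 * t ^ 7

def elimConst (a t : A) : A :=
  10368 * a ^ 6 * t ^ 3 + 124416 * a ^ 5 * t ^ 4 + 678456 * a ^ 4 * t ^ 5 +
    2109888 * a ^ 3 * t ^ 6 + 3912786 * a ^ 2 * t ^ 7 + 4080456 * a * t ^ 8 + 1877580 * t ^ 9

def elimLead (a t : A) : A := 4 * a * (a + 3 * t)

def elimSlope (a t : A) : A := elimLead a t * elimLin a t - elimQuad a t * elimL a t

def elimIntercept (a t : A) : A := elimLead a t * elimConst a t - elimQuad a t * elimK a t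

/-- The resultant of the two eliminated equations. -/
def elimResultant (a t : A) : A :=
  elimLead a t * elimIntercept a t ^ 2 - elimL a t * elimIntercept a t * elimSlope a t +
    elimK a t * elimSlope a t ^ 2

/-- All the coefficient polynomials are homogeneous, so where `t ≠ 0` the vanishing of the resultant
is a condition on the ratio `a / t` alone. -/
theorem elimResultant_homogeneous (r t : A) :
    elimResultant (r * t) t = t ^ 24 * elimResultant r 1 := by
  have h1 : elimL (r * t) t = t ^ 4 * elimL r 1 := by simp only [elimL]; ring
  have h2 : elimK (r * t) t = t ^ 6 * elimK r 1 := by simp only [elimK]; ring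
  have h3 : elimQuad (r * t) t = t ^ 5 * elimQuad r 1 := by simp only [elimQuad]; ring
  have h4 : elimLin (r * t) t = t ^ 7 * elimLin r 1 := by simp only [elimLin]; ring
  have h5 : elimConst (r * t) t = t ^ 9 * elimConst r 1 := by simp only [elimConst]; ring
  have h6 : elimLead (r * t) t = t ^ 2 * elimLead r 1 := by simp only [elimLead]; ring
  simp only [elimResultant, elimIntercept, elimSlope, h1, h2, h3, h4, h5, h6]
  ring

/-- The set of admissible ratios is finite. -/
theorem finite_elimResultant_roots : {r : ℝ | elimResultant r 1 = 0}.Finite := by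
  let P : Polynomial ℝ := elimResultant Polynomial.X 1
  have hP : ∀ r, P.eval r = elimResultant r 1 := by
    intro r
    simp [P, elimResultant, elimIntercept, elimSlope, elimLead, elimL, elimK, elimQuad, elimLin,
      elimConst]
  have hne : P ≠ 0 := by
    intro h0
    -- One nonzero value shows that the polynomial is not identically zero; 1 is a convenient test
    -- point.
    have := hP 1
    rw [h0] at this
    norm_num [elimResultant, elimIntercept, elimSlope, elimLead, elimL, elimK, elimQuad, elimLin,
      elimConst] at this
  refine (P.roots.toFinset.finite_toSet).subset fun r hr => ?_
  have : P.IsRoot r := (hP r).trans hr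
  simpa [hne] using this

/-- With `a = k₁ - k₃` and `t = k₃`, the ratio `-1` means `k₁ = 0`. The constant-ratio argument
divides by `k₁ / k₃` and must rule this out. -/
theorem elimResultant_neg_one : elimResultant (-1 : ℝ) 1 ≠ 0 := by
  norm_num [elimResultant, elimIntercept, elimSlope, elimLead, elimL, elimK, elimQuad, elimLin,
    elimConst]

/-- Since `k₄ = -5t - 2a`, this ratio means `k₄ = 0`, the other excluded division. -/
theorem elimResultant_neg_five_halves : elimResultant (-5 / 2 : ℝ) 1 ≠ 0 := by
  norm_num [elimResultant, elimIntercept, elimSlope, elimLead, elimL, elimK, elimQuad, elimLin,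
    elimConst]

variable [Algebra ℝ A]

theorem eq_zero_of_ofNat_mul (n : ℕ) [n.AtLeastTwo] {z : A} (h : (OfNat.ofNat n : A) * z = 0) :
    z = 0 := by
  have hn : ((OfNat.ofNat n : ℝ)) ≠ 0 := OfNat.ofNat_ne_zero n
  have h2 : algebraMap ℝ A (OfNat.ofNat n)⁻¹ * OfNat.ofNat n = 1 := by
    rw [← map_ofNat (algebraMap ℝ A) n, ← map_mul, inv_mul_cancel₀ hn, map_one]
  linear_combination algebraMap ℝ A (OfNat.ofNat n)⁻¹ * h - z * h2

theorem Derivation.map_ofNat_eq_zero (D : Derivation ℝ A A) (n : ℕ) [n.AtLeastTwo] :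
    D (no_index (OfNat.ofNat n : A)) = 0 := by
  rw [← map_ofNat (algebraMap ℝ A) n, Derivation.map_algebraMap]

/-- The relation `hXY` expresses `XY` through `a` and `t`. Differentiating it, multiplying by `X`
and replacing `XY` gives a quadratic `hG` in `X²` over the polynomials in `a`, `t`. Doing the same
to `hG` gives a second quadratic `hF`; the resultant condition follows by eliminating `X²`. -/
theorem elimResultant_eq_zero_of_flow {δ : Derivation ℝ A A} {a t X Y : A}
    (ha : δ a = (5 * a - 6 * t - 2 * a) * Y + 12 * a * (a + 3 * t) * X)
    (ht : δ t = 6 * t * Y - 6 * a * (a + 3 * t) * X)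
    (hX : δ X = 3 * (X * (2 * Y + (a + 6 * t) * X) + 9 * t * (a + 2 * t) ^ 2))
    (hY : δ Y = 3 * (2 * (Y ^ 2 + 2 * a * (a + 3 * t) * X ^ 2) + 3 * t * (a * (a + t) +
      (6 * t + 2 * a) * (-5 * t - 2 * a)) * (a + 2 * t)) -
      (6 * t * Y - 6 * a * (a + 3 * t) * X) * X)
    (hXY : 2 * (X * Y) + 9 * t * (4 * a ^ 2 + 16 * a * t + 19 * t ^ 2) = 0) :
    elimResultant a t = 0 := by
  have d1 := congrArg δ hXY
  simp only [map_add, map_zero, Derivation.leibniz, Derivation.leibniz_pow, smul_eq_mul, ha, ht,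
    hX, hY, Derivation.map_ofNat_eq_zero, mul_zero, add_zero] at d1
  have hG : elimLead a t * X ^ 4 + elimL a t * X ^ 2 + elimK a t = 0 := by
    refine eq_zero_of_ofNat_mul 36 ?_
    simp only [elimLead, elimL, elimK]
    linear_combination 4 * X * d1 - (108 * a ^ 2 * t + 432 * a * t ^ 2 + 12 * a * X ^ 2 +
      756 * t ^ 3 + 48 * t * X ^ 2 + 48 * X * Y) * hXY
  have d2 := congrArg δ hG
  simp only [elimLead, elimL, elimK, map_add, map_neg, map_zero, Derivation.leibniz,
    Derivation.leibniz_pow, smul_eq_mul, ha, ht, hX, Derivation.map_ofNat_eq_zero, mul_zero,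
    add_zero] at d2
  have hF : elimQuad a t * X ^ 4 + elimLin a t * X ^ 2 + elimConst a t = 0 := by
    refine eq_zero_of_ofNat_mul 9 ?_
    simp only [elimLead, elimL, elimK, elimQuad, elimLin, elimConst] at hG ⊢
    linear_combination 2 * X * d2 - 36 * (a + 6 * t) * X ^ 2 * hG -
      (-2592 * a ^ 4 * t ^ 2 - 576 * a ^ 4 * X ^ 2 - 20736 * a ^ 3 * t ^ 3 -
      4446 * a ^ 3 * t * X ^ 2 - 74358 * a ^ 2 * t ^ 4 - 14292 * a ^ 2 * t ^ 2 * X ^ 2 +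
      120 * a ^ 2 * X ^ 4 - 131544 * a * t ^ 5 - 20763 * a * t ^ 3 * X ^ 2 + 348 * a * t * X ^ 4 -
      98820 * t ^ 6 - 7470 * t ^ 4 * X ^ 2 - 72 * t ^ 2 * X ^ 4) * hXY
  -- Cancelling the `X⁴` terms leaves an equation linear in `X²`; substituting it into `hG`, with
  -- denominators cleared, gives the resultant.
  have hl : elimSlope a t * X ^ 2 + elimIntercept a t = 0 := by
    simp only [elimSlope, elimIntercept]
    linear_combination elimLead a t * hF - elimQuad a t * hG
  simp only [elimResultant]
  linear_combination (elimSlope a t ^ 2) * hG + (elimLead a t * elimIntercept a t -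
    elimLead a t * elimSlope a t * X ^ 2 - elimL a t * elimSlope a t) * hl

/-- The differential system for the principal curvatures along the gradient of `s₁` forces the
ratio of the principal curvatures to be a root of a fixed polynomial. -/
theorem elimResultant_eq_zero {D : Derivation ℝ A A} {k₁ k₃ k₄ p q : A}
    (htr : 3 * k₃ = -2 * k₁ - k₄) (h1 : D k₁ = (k₁ - k₃) * p) (h4 : D k₄ = (k₄ - k₃) * q)
    (hp : D p = p ^ 2 + k₁ * k₃) (hq : D q = q ^ 2 + k₃ * k₄)
    (hk : D (D k₃) = (2 * p + q) * D k₃ + k₃ * (2 * k₁ ^ 2 + k₃ ^ 2 + k₄ ^ 2)) :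
    elimResultant (k₁ - k₃) k₃ = 0 := by
  obtain ⟨a, rfl⟩ : ∃ a, k₁ = a + k₃ := ⟨k₁ - k₃, by ring⟩
  obtain rfl : k₄ = -5 * k₃ - 2 * a := by linear_combination htr
  have hy : 3 * D k₃ = -2 * a * p + (6 * k₃ + 2 * a) * q := by
    simp only [map_add, map_sub, map_neg, Derivation.leibniz, smul_eq_mul,
      Derivation.map_ofNat_eq_zero, mul_zero, add_zero, neg_zero] at h1 h4
    linear_combination -2 * h1 - h4
  have ha : D a = a * p - D k₃ := by
    rw [map_add] at h1
    linear_combination h1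
  have hyy := congrArg D hy
  simp only [map_add, map_neg, Derivation.leibniz, smul_eq_mul, ha, hp, hq,
      Derivation.map_ofNat_eq_zero, mul_zero, add_zero, neg_zero, hk] at hyy
  -- There are two expressions for the second derivative of `k₃`: the derivative of `hy`, and `hk`.
  -- Their difference involves no derivatives once `hy` is used again.
  have hXY : 2 * ((p - q) * (a * p + (6 * k₃ + 2 * a) * q)) +
      9 * k₃ * (4 * a ^ 2 + 16 * a * k₃ + 19 * k₃ ^ 2) = 0 := by
    refine eq_zero_of_ofNat_mul 2 ?_
    linear_combination 3 * hyy + (-4 * p + q) * hy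
  rw [add_sub_cancel_right]
  -- The change from `(p, q)` to `(X, Y)` has determinant `3a + 6k₃`, and `hy` carries a factor 3.
  -- Scaling `D` by their product makes the flow polynomial in `a`, `k₃`, `X`, `Y`.
  refine elimResultant_eq_zero_of_flow (δ := (9 * a + 18 * k₃) • D) (X := p - q)
    (Y := a * p + (6 * k₃ + 2 * a) * q) ?_ ?_ ?_ ?_ hXY
  · rw [Derivation.smul_apply, ha, smul_eq_mul]
    linear_combination (-3 * a - 6 * k₃) * hy
  · rw [Derivation.smul_apply, smul_eq_mul]
    linear_combination (3 * a + 6 * k₃) * hy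
  · rw [Derivation.smul_apply, smul_eq_mul, map_sub, hp, hq]
    ring
  · rw [Derivation.smul_apply, smul_eq_mul]
    simp only [map_add, Derivation.leibniz, smul_eq_mul, ha, hp, hq,
      Derivation.map_ofNat_eq_zero, mul_zero, add_zero]
    linear_combination (3 * a + 6 * k₃) * (-p + 4 * q) * hy

end Elimination
end

/-! ### Exclusion of a constant ratio of principal curvatures. -/

noncomputable section

section ConstantRatio

/-- Here `t = k₃`, `κ = k₁/k₃`, `-3 - 2κ = k₄/k₃`, and `y`, `z` are the first two derivatives of
`t`. The equations for `k₁` and `k₄` make `y²` and `tz` definite multiples of `t⁴`; then `e5`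
demands `4(κ + 1)² + 6 = 0`. -/
theorem not_constant_ratio_system {κ t y z p q : ℝ} (ht : t ≠ 0) (h0 : κ ≠ 0) (h0' : -3 - 2 * κ ≠ 0)
    (h1 : κ - 1 ≠ 0) (h1' : -4 - 2 * κ ≠ 0) (h2 : 3 + 3 * κ ≠ 0)
    (e1 : κ * y = (κ - 1) * t * p) (e2 : (-3 - 2 * κ) * y = (-4 - 2 * κ) * t * q)
    (e3 : κ * z = (κ - 1) * (y * p + t * (p ^ 2 + κ * t ^ 2)))
    (e4 : (-3 - 2 * κ) * z = (-4 - 2 * κ) * (y * q + t * (q ^ 2 + (-3 - 2 * κ) * t ^ 2)))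
    (e5 : z = (2 * p + q) * y + t ^ 3 * (2 * κ ^ 2 + 1 + (-3 - 2 * κ) ^ 2)) : False := by
  have f1 : (κ - 1) * t * z = (2 * κ - 1) * y ^ 2 + (κ - 1) ^ 2 * t ^ 4 := by
    refine mul_left_cancel₀ h0 ?_
    linear_combination (κ - 1) * t * e3 - ((κ - 1) * y + κ * y + (κ - 1) * t * p) * e1
  have f2 : (-4 - 2 * κ) * t * z = (2 * (-3 - 2 * κ) - 1) * y ^ 2 + (-4 - 2 * κ) ^ 2 * t ^ 4 := by
    refine mul_left_cancel₀ h0' ?_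
    linear_combination (-4 - 2 * κ) * t * e4 -
      ((-4 - 2 * κ) * y + (-3 - 2 * κ) * y + (-4 - 2 * κ) * t * q) * e2
  -- Eliminating `z` leaves the factor `3 + 3κ`, the difference of the ratios `k₁/k₃` and `k₄/k₃`.
  have f3 : y ^ 2 = (κ - 1) * (-4 - 2 * κ) * t ^ 4 := by
    refine mul_left_cancel₀ h2 ?_
    linear_combination (-4 - 2 * κ) * f1 - (κ - 1) * f2
  have f4 : t * z = ((2 * κ - 1) * (-4 - 2 * κ) + (κ - 1)) * t ^ 4 := by
    refine mul_left_cancel₀ h1 ?_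
    linear_combination f1 + (2 * κ - 1) * f3
  have f5 : t * z = (2 * κ * (-4 - 2 * κ) + (-3 - 2 * κ) * (κ - 1) +
      (2 * κ ^ 2 + 1 + (-3 - 2 * κ) ^ 2)) * t ^ 4 := by
    refine mul_left_cancel₀ (mul_ne_zero h1 h1') ?_
    linear_combination (κ - 1) * (-4 - 2 * κ) * t * e5 - 2 * (-4 - 2 * κ) * y * e1 -
      (κ - 1) * y * e2 + (2 * κ * (-4 - 2 * κ) + (-3 - 2 * κ) * (κ - 1)) * f3
  have f6 : (4 * (κ + 1) ^ 2 + 6) * t ^ 4 = 0 := by linear_combination f4 - f5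
  have : 0 < (4 * (κ + 1) ^ 2 + 6) * t ^ 4 := by positivity
  exact this.ne' f6

variable {A : Type*} [CommRing A] [Algebra ℝ A]

theorem AlgHom.map_ofNat_eq (φ : A →ₐ[ℝ] ℝ) (n : ℕ) [n.AtLeastTwo] :
    φ (no_index (OfNat.ofNat n : A)) = OfNat.ofNat n :=
  map_ofNat φ n

theorem map_elimResultant (φ : A →ₐ[ℝ] ℝ) (a t : A) :
    φ (elimResultant a t) = elimResultant (φ a) (φ t) := by
  simp [AlgHom.map_ofNat_eq, elimResultant, elimIntercept, elimSlope, elimLead, elimL, elimK,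
    elimQuad, elimLin, elimConst]

/-- The principal curvatures cannot have a constant ratio. -/
theorem not_constant_ratio {D : Derivation ℝ A A} {k₁ k₃ k₄ p q : A} (φ : A →ₐ[ℝ] ℝ) {κ : ℝ}
    (hκ : k₁ = algebraMap ℝ A κ * k₃)
    (htr : 3 * k₃ = -2 * k₁ - k₄) (h1 : D k₁ = (k₁ - k₃) * p) (h4 : D k₄ = (k₄ - k₃) * q)
    (hp : D p = p ^ 2 + k₁ * k₃) (hq : D q = q ^ 2 + k₃ * k₄)
    (hk : D (D k₃) = (2 * p + q) * D k₃ + k₃ * (2 * k₁ ^ 2 + k₃ ^ 2 + k₄ ^ 2))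
    (ht : φ k₃ ≠ 0) (h₁₃ : φ k₁ - φ k₃ ≠ 0) (h₁₄ : φ k₁ - φ k₄ ≠ 0) (h₃₄ : φ k₃ - φ k₄ ≠ 0) :
    False := by
  have hR := congrArg φ (elimResultant_eq_zero htr h1 h4 hp hq hk)
  obtain ⟨μ, hμ⟩ : ∃ μ : ℝ, μ = -3 - 2 * κ := ⟨_, rfl⟩
  obtain rfl : k₄ = algebraMap ℝ A μ * k₃ := by
    simp only [hμ, map_sub, map_neg, map_mul, map_ofNat]
    linear_combination htr - 2 * hκ
  subst hκ
  have hD : ∀ c f, D (algebraMap ℝ A c * f) = algebraMap ℝ A c * D f := by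
    intro c f
    rw [Derivation.leibniz, Derivation.map_algebraMap]
    simp
  have d1 := congrArg D h1
  have d4 := congrArg D h4
  simp only [hD, Derivation.leibniz, map_sub, smul_eq_mul, hp, hq] at d1 d4
  rw [hD] at h1 h4
  have e1 := congrArg φ h1
  have e2 := congrArg φ h4
  have e3 := congrArg φ d1
  have e4 := congrArg φ d4
  have e5 := congrArg φ hk
  simp only [map_mul, map_sub, map_add, map_pow, AlgHom.commutes, map_elimResultant, map_zero,
    AlgHom.map_ofNat_eq, Algebra.algebraMap_self, RingHom.id_apply] at *
  generalize φ k₃ = t at *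
  generalize φ (D k₃) = y at *
  generalize φ (D (D k₃)) = z at *
  generalize φ p = P at *
  generalize φ q = Q at *
  subst hμ
  rw [show κ * t - t = (κ - 1) * t by ring, elimResultant_homogeneous] at hR
  have hroot : elimResultant (κ - 1) 1 = 0 := (mul_eq_zero.1 hR).resolve_left (pow_ne_zero _ ht)
  -- That `k₁` and `k₄` are nonzero at the point comes from the resultant; the other inequalities
  -- come from distinctness of the curvatures.
  refine not_constant_ratio_system (κ := κ) (t := t) (y := y) (z := z) (p := P) (q := Q) ht
    ?_ ?_ ?_ ?_ ?_ ?_ ?_ ?_ ?_ ?_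
  · rintro rfl
    exact elimResultant_neg_one (by simpa using hroot)
  · intro h
    obtain rfl : κ = -3 / 2 := by linarith
    exact elimResultant_neg_five_halves (by rw [← hroot]; norm_num)
  · intro h
    exact h₁₃ (by linear_combination t * h)
  · intro h
    exact h₃₄ (by linear_combination -t * h)
  · intro h
    exact h₁₄ (by linear_combination t * h)
  · linear_combination e1
  · linear_combination e2
  · linear_combination e3
  · linear_combination e4
  · linear_combination e5

end ConstantRatio
end

/-! ### Vector fields as directional derivatives, and their brackets. -/

noncomputable section

section DirectionalDerivative

variable {M : Type*} [TopologicalSpace M] [ChartedSpace (EuclideanSpace ℝ (Fin 4)) M]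
  {F : Type*} [NormedAddCommGroup F] [NormedSpace ℝ F]

theorem diffReal_congr {f g : M → ℝ} {p : M} (h : f =ᶠ[nhds p] g) : diffReal f p = diffReal g p := by
  have := h.mfderiv_eq (I := 𝓡 4) (I' := 𝓘(ℝ, ℝ))
  ext v
  exact congrArg (fun L : EuclideanSpace ℝ (Fin 4) →L[ℝ] ℝ => L v) this

/-- The part of the chart domain around `p` that corresponds to `U`. -/
def chartDomain (U : Set M) (p : M) : Set (EuclideanSpace ℝ (Fin 4)) :=
  (extChartAt (𝓡 4) p).target ∩ (extChartAt (𝓡 4) p).symm ⁻¹' U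

theorem isOpen_chartDomain {U : Set M} (hU : IsOpen U) (p : M) : IsOpen (chartDomain U p) :=
  (continuousOn_extChartAt_symm p).isOpen_inter_preimage (isOpen_extChartAt_target p) hU

theorem mem_chartDomain {U : Set M} {p : M} (hp : p ∈ U) :
    extChartAt (𝓡 4) p p ∈ chartDomain U p :=
  ⟨mem_extChartAt_target p, by simpa using hp⟩

variable [IsManifold (𝓡 4) ∞ M]

instance instIsManifoldOneOfSmooth : IsManifold (𝓡 4) 1 M := IsManifold.of_le (n := ∞) (by simp)

/-- The derivative of a smooth function along a smooth vector field is smooth. -/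
theorem contMDiffOn_mvfderiv_apply {U : Set M} (hU : IsOpen U) {f : M → F}
    (hf : ContMDiffOn (𝓡 4) 𝓘(ℝ, F) ∞ f U) {V : (q : M) → TangentSpace (𝓡 4) q}
    (hV : ContMDiffOn (𝓡 4) (𝓡 4).tangent ∞ (fun q => (⟨q, V q⟩ : TangentBundle (𝓡 4) M)) U) :
    ContMDiffOn (𝓡 4) 𝓘(ℝ, F) ∞ (fun q => mvfderiv (𝓡 4) f q (V q)) U := by
  have h1 := hf.contMDiffOn_tangentMapWithin (m := ∞) (by simp) hU.uniqueMDiffOn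
  have h2 := h1.comp hV (fun q hq => hq)
  have h3 := (contMDiff_snd_tangentBundle_modelSpace F 𝓘(ℝ, F) (n := ∞)).comp_contMDiffOn h2
  refine h3.congr fun q hq => ?_
  have : mfderivWithin (𝓡 4) 𝓘(ℝ, F) f U q = mfderiv (𝓡 4) 𝓘(ℝ, F) f q :=
    mfderivWithin_of_isOpen hU hq
  change mfderiv (𝓡 4) 𝓘(ℝ, F) f q (V q) = mfderivWithin (𝓡 4) 𝓘(ℝ, F) f U q (V q)
  rw [this]

theorem contDiffOn_comp_chart_symm {U : Set M} {f : M → F}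
    (hf : ContMDiffOn (𝓡 4) 𝓘(ℝ, F) ∞ f U) (p : M) :
    ContDiffOn ℝ ∞ (f ∘ (extChartAt (𝓡 4) p).symm) (chartDomain U p) := by
  rw [← contMDiffOn_iff_contDiffOn]
  exact hf.comp ((contMDiffOn_extChartAt_symm p).mono Set.inter_subset_left)
    (fun y hy => hy.2)

theorem mvfderiv_eq_fderiv_chart {U : Set M} (hU : IsOpen U) {f : M → F}
    (hf : ContMDiffOn (𝓡 4) 𝓘(ℝ, F) ∞ f U) {p q : M} (hqU : q ∈ U)
    (hq : q ∈ (extChartAt (𝓡 4) p).source) (v : TangentSpace (𝓡 4) q) :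
    mvfderiv (𝓡 4) f q v = fderiv ℝ (f ∘ (extChartAt (𝓡 4) p).symm) (extChartAt (𝓡 4) p q)
      (mvfderiv (𝓡 4) (extChartAt (𝓡 4) p) q v) := by
  set ψ := extChartAt (𝓡 4) p
  have hy : ψ q ∈ chartDomain U p := ⟨ψ.map_source hq, by
    change ψ.symm (ψ q) ∈ U
    rwa [ψ.left_inv hq]⟩
  have h1 : DifferentiableAt ℝ (f ∘ ψ.symm) (ψ q) :=
    ((contDiffOn_comp_chart_symm hf p).differentiableOn (by simp)).differentiableAt
      ((isOpen_chartDomain hU p).mem_nhds hy)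
  have h2 : MDifferentiableAt (𝓡 4) 𝓘(ℝ, EuclideanSpace ℝ (Fin 4)) ψ q :=
    mdifferentiableAt_extChartAt (by simpa [ψ] using hq)
  have h3 : f =ᶠ[nhds q] (f ∘ ψ.symm) ∘ ψ := by
    filter_upwards [(isOpen_extChartAt_source (I := 𝓡 4) p).mem_nhds hq] with r hr
    simp only [Function.comp_apply]
    rw [ψ.left_inv hr]
  have h4 : mfderiv (𝓡 4) 𝓘(ℝ, F) f q = mfderiv (𝓡 4) 𝓘(ℝ, F) ((f ∘ ψ.symm) ∘ ψ) q :=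
    h3.mfderiv_eq
  have h5 := mfderiv_comp q h1.mdifferentiableAt h2
  rw [mfderiv_eq_fderiv] at h5
  change mfderiv (𝓡 4) 𝓘(ℝ, F) f q v = _
  rw [h4, h5]
  rfl

/-- The commutator of the derivatives along two vector fields is the derivative in the direction
of a tangent vector. -/
theorem exists_bracket {U : Set M} (hU : IsOpen U) {V W : (q : M) → TangentSpace (𝓡 4) q}
    (hV : ContMDiffOn (𝓡 4) (𝓡 4).tangent ∞ (fun q => (⟨q, V q⟩ : TangentBundle (𝓡 4) M)) U)
    (hW : ContMDiffOn (𝓡 4) (𝓡 4).tangent ∞ (fun q => (⟨q, W q⟩ : TangentBundle (𝓡 4) M)) U)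
    {p : M} (hp : p ∈ U) :
    ∃ w : TangentSpace (𝓡 4) p, ∀ f : M → ℝ, ContMDiffOn (𝓡 4) 𝓘(ℝ, ℝ) ∞ f U →
      diffReal (fun q => diffReal f q (W q)) p (V p) -
        diffReal (fun q => diffReal f q (V q)) p (W p) = diffReal f p w := by
  set ψ := extChartAt (𝓡 4) p with hψ
  have hUs : IsOpen (U ∩ ψ.source) := hU.inter (isOpen_extChartAt_source p)
  have hps : p ∈ ψ.source := mem_extChartAt_source p
  have hψs : ContMDiffOn (𝓡 4) 𝓘(ℝ, EuclideanSpace ℝ (Fin 4)) ∞ ψ (U ∩ ψ.source) := by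
    refine contMDiffOn_extChartAt.mono fun q hq => ?_
    simpa [ψ] using hq.2
  have hΩ := isOpen_chartDomain hU p
  have hpΩ := mem_chartDomain hp
  have hnhds : chartDomain U p ∈ nhds (ψ p) := hΩ.mem_nhds hpΩ
  have hfield : ∀ {X : (q : M) → TangentSpace (𝓡 4) q},
      ContMDiffOn (𝓡 4) (𝓡 4).tangent ∞ (fun q => (⟨q, X q⟩ : TangentBundle (𝓡 4) M)) U →
      DifferentiableAt ℝ ((fun q => mvfderiv (𝓡 4) ψ q (X q)) ∘ ψ.symm) (ψ p) := by
    intro X hX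
    have h1 := contMDiffOn_mvfderiv_apply hUs hψs (hX.mono Set.inter_subset_left)
    exact ((contDiffOn_comp_chart_symm h1 p).differentiableOn (by simp)).differentiableAt
      ((isOpen_chartDomain hUs p).mem_nhds (mem_chartDomain ⟨hp, hps⟩))
  have hloc : ∀ {X : (q : M) → TangentSpace (𝓡 4) q} {f : M → ℝ},
      ContMDiffOn (𝓡 4) 𝓘(ℝ, ℝ) ∞ f U →
      (fun q => diffReal f q (X q)) ∘ ψ.symm =ᶠ[nhds (ψ p)] fun y => fderiv ℝ (f ∘ ψ.symm) y
        (((fun q => mvfderiv (𝓡 4) ψ q (X q)) ∘ ψ.symm) y) := by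
    intro X f hf
    filter_upwards [hnhds] with y hy
    have h1 := mvfderiv_eq_fderiv_chart hU hf (p := p) hy.2 (ψ.map_target hy.1) (X (ψ.symm y))
    rw [← hψ, ψ.right_inv hy.1] at h1
    exact h1
  obtain ⟨V', hV'⟩ : ∃ V' : EuclideanSpace ℝ (Fin 4) → EuclideanSpace ℝ (Fin 4),
      V' = (fun q => mvfderiv (𝓡 4) ψ q (V q)) ∘ ψ.symm := ⟨_, rfl⟩
  obtain ⟨W', hW'⟩ : ∃ W' : EuclideanSpace ℝ (Fin 4) → EuclideanSpace ℝ (Fin 4),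
      W' = (fun q => mvfderiv (𝓡 4) ψ q (W q)) ∘ ψ.symm := ⟨_, rfl⟩
  obtain ⟨b, hb'⟩ : ∃ b : EuclideanSpace ℝ (Fin 4),
      b = VectorField.lieBracket ℝ V' W' (ψ p) := ⟨_, rfl⟩
  -- The coordinate bracket `b` serves directly as a tangent vector at `p`, because the preferred
  -- chart at `p` has identity derivative there (`hself`).
  refine ⟨b, fun f hf => ?_⟩
  have hb := VectorField.fderiv_apply_lieBracket (f := f ∘ ψ.symm) (n := ∞)
    ((contDiffOn_comp_chart_symm hf p).contDiffAt hnhds)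
    (by simpa using (WithTop.coe_le_coe.2 le_top : ((2 : ℕ∞) : WithTop ℕ∞) ≤ ∞))
    (hW' ▸ hfield hW : DifferentiableAt ℝ W' (ψ p)) (hV' ▸ hfield hV : DifferentiableAt ℝ V' (ψ p))
  have hself : ∀ v : EuclideanSpace ℝ (Fin 4), mvfderiv (𝓡 4) ψ p v = v := by
    intro v
    have := mfderiv_extChartAt_self (I := 𝓡 4) (x := p)
    change mfderiv (𝓡 4) 𝓘(ℝ, EuclideanSpace ℝ (Fin 4)) (extChartAt (𝓡 4) p) p v = v
    rw [this]
    rfl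
  have hd : ∀ {X Z : (q : M) → TangentSpace (𝓡 4) q},
      ContMDiffOn (𝓡 4) (𝓡 4).tangent ∞ (fun q => (⟨q, X q⟩ : TangentBundle (𝓡 4) M)) U →
      diffReal (fun q => diffReal f q (X q)) p (Z p) = fderiv ℝ (fun y => fderiv ℝ (f ∘ ψ.symm) y
        (((fun q => mvfderiv (𝓡 4) ψ q (X q)) ∘ ψ.symm) y)) (ψ p)
        (((fun q => mvfderiv (𝓡 4) ψ q (Z q)) ∘ ψ.symm) (ψ p)) := by
    intro X Z hX
    have h1 := mvfderiv_eq_fderiv_chart hU (contMDiffOn_mvfderiv_apply hU hf hX) hp hps (Z p)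
    rw [← (hloc hf).fderiv_eq]
    refine h1.trans ?_
    simp only [Function.comp_apply]
    rw [ψ.left_inv hps]
    rfl
  rw [hd hW, hd hV, ← hV', ← hW']
  rw [← hb'] at hb
  refine hb.symm.trans ?_
  have h6 := mvfderiv_eq_fderiv_chart hU hf hp hps b
  rw [← hψ, hself] at h6
  exact h6.symm

end DirectionalDerivative
end

/-! ### The algebra of smooth functions on an open set and its derivations. -/

noncomputable section

section SmoothFunctions

variable {M : Type*} [TopologicalSpace M] [ChartedSpace (EuclideanSpace ℝ (Fin 4)) M]

/-- The algebra of smooth functions on an open set of `M`. -/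
def smoothFunctions (U : TopologicalSpace.Opens M) : Subalgebra ℝ (U → ℝ) where
  -- Elements are functions on `U`, so that equality means equality on `U`; the witness lives on `M`
  -- because derivatives are taken of functions on `M`. Its values off `U` do not matter.
  carrier := {f | ∃ F : M → ℝ, ContMDiffOn (𝓡 4) 𝓘(ℝ, ℝ) ∞ F U ∧ ∀ q : U, f q = F q}
  mul_mem' := by
    rintro f g ⟨F, hF, hf⟩ ⟨G, hG, hg⟩
    exact ⟨fun q => F q * G q, hF.mul hG, fun q => by simp [hf, hg]⟩
  add_mem' := by
    rintro f g ⟨F, hF, hf⟩ ⟨G, hG, hg⟩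
    exact ⟨fun q => F q + G q, hF.add hG, fun q => by simp [hf, hg]⟩
  algebraMap_mem' c := ⟨fun _ => c, contMDiffOn_const, fun q => rfl⟩

variable {U : TopologicalSpace.Opens M}

/-- The restriction of a function that is smooth on `U`. -/
def toSmooth (F : M → ℝ) (hF : ContMDiffOn (𝓡 4) 𝓘(ℝ, ℝ) ∞ F U) : smoothFunctions U :=
  ⟨fun q => F q, F, hF, fun _ => rfl⟩

/-- Evaluation at a point. -/
def evalSmooth (q : U) : smoothFunctions U →ₐ[ℝ] ℝ :=
  (Pi.evalAlgHom ℝ (fun _ : U => ℝ) q).comp (smoothFunctions U).val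

@[simp] theorem evalSmooth_toSmooth (q : U) (F : M → ℝ)
    (hF : ContMDiffOn (𝓡 4) 𝓘(ℝ, ℝ) ∞ F U) : evalSmooth q (toSmooth F hF) = F q := rfl

theorem smooth_ext {f g : smoothFunctions U} (h : ∀ q, evalSmooth q f = evalSmooth q g) : f = g :=
  Subtype.ext (funext h)

/-- Smooth functions form a ring with zero divisors; this supplies the cancellation hypotheses of
the algebraic part. -/
theorem smooth_regular {f : smoothFunctions U} (h : ∀ q, evalSmooth q f ≠ 0)
    (z : smoothFunctions U) (hz : f * z = 0) : z = 0 := by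
  refine smooth_ext fun q => ?_
  have := congrArg (evalSmooth q) hz
  rw [map_mul, map_zero] at this
  rw [map_zero]
  exact (mul_eq_zero.1 this).resolve_left (h q)

instance instIsReducedSmoothFunctions : IsReduced (smoothFunctions U) where
  eq_zero f := by
    rintro ⟨n, hn⟩
    refine smooth_ext fun q => ?_
    have := congrArg (evalSmooth q) hn
    rw [map_pow, map_zero] at this
    rw [map_zero]
    exact eq_zero_of_pow_eq_zero this

/-- The extension of a smooth function on `U` by zero. -/
def extendSmooth (f : smoothFunctions U) : M → ℝ := Function.extend Subtype.val f.1 0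

theorem extendSmooth_apply (f : smoothFunctions U) (q : U) : extendSmooth f q = evalSmooth q f :=
  Subtype.val_injective.extend_apply _ _ _

theorem contMDiffOn_extendSmooth (f : smoothFunctions U) :
    ContMDiffOn (𝓡 4) 𝓘(ℝ, ℝ) ∞ (extendSmooth f) U := by
  obtain ⟨F, hF, hf⟩ := f.2
  refine hF.congr fun q hq => ?_
  rw [extendSmooth_apply f ⟨q, hq⟩]
  exact hf ⟨q, hq⟩

theorem toSmooth_extendSmooth (f : smoothFunctions U) :
    toSmooth (extendSmooth f) (contMDiffOn_extendSmooth f) = f :=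
  smooth_ext fun q => extendSmooth_apply f q

theorem exists_toSmooth (f : smoothFunctions U) :
    ∃ (F : M → ℝ) (hF : ContMDiffOn (𝓡 4) 𝓘(ℝ, ℝ) ∞ F U), toSmooth F hF = f :=
  ⟨_, _, toSmooth_extendSmooth f⟩

theorem mdifferentiableAt_of_contMDiffOn {F : Type*} [NormedAddCommGroup F] [NormedSpace ℝ F]
    {f : M → F} {U : Set M} (hU : IsOpen U)
    (hf : ContMDiffOn (𝓡 4) 𝓘(ℝ, F) ∞ f U) {q : M} (hq : q ∈ U) :
    MDifferentiableAt (𝓡 4) 𝓘(ℝ, F) f q :=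
  (hf.contMDiffAt (hU.mem_nhds hq)).mdifferentiableAt (by simp)

theorem diffReal_add {f g : M → ℝ} {q : M} (hf : MDifferentiableAt (𝓡 4) 𝓘(ℝ, ℝ) f q)
    (hg : MDifferentiableAt (𝓡 4) 𝓘(ℝ, ℝ) g q) (v : TangentSpace (𝓡 4) q) :
    diffReal (fun r => f r + g r) q v = diffReal f q v + diffReal g q v := by
  have := mfderiv_add hf hg
  exact congrArg (fun L : EuclideanSpace ℝ (Fin 4) →L[ℝ] ℝ => L v) this

theorem diffReal_mul {f g : M → ℝ} {q : M} (hf : MDifferentiableAt (𝓡 4) 𝓘(ℝ, ℝ) f q)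
    (hg : MDifferentiableAt (𝓡 4) 𝓘(ℝ, ℝ) g q) (v : TangentSpace (𝓡 4) q) :
    diffReal (fun r => f r * g r) q v = f q * diffReal g q v + g q * diffReal f q v := by
  have := mvfderiv_mul hf hg
  exact congrArg (fun L : EuclideanSpace ℝ (Fin 4) →L[ℝ] ℝ => L v) this

theorem diffReal_const (c : ℝ) (q : M) (v : TangentSpace (𝓡 4) q) :
    diffReal (fun _ => c) q v = 0 := by
  have := mfderiv_const (I := 𝓡 4) (I' := 𝓘(ℝ, ℝ)) (c := c) (x := q)
  exact congrArg (fun L : EuclideanSpace ℝ (Fin 4) →L[ℝ] ℝ => L v) this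

variable [IsManifold (𝓡 4) ∞ M]

theorem contMDiffOn_diffReal_apply {f : M → ℝ} (hf : ContMDiffOn (𝓡 4) 𝓘(ℝ, ℝ) ∞ f U)
    {V : (q : M) → TangentSpace (𝓡 4) q}
    (hV : ContMDiffOn (𝓡 4) (𝓡 4).tangent ∞ (fun q => (⟨q, V q⟩ : TangentBundle (𝓡 4) M)) U) :
    ContMDiffOn (𝓡 4) 𝓘(ℝ, ℝ) ∞ (fun q => diffReal f q (V q)) U :=
  contMDiffOn_mvfderiv_apply U.2 hf hV

/-- The derivation of the algebra of smooth functions that a smooth vector field defines. -/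
def fieldDerivation (V : (q : M) → TangentSpace (𝓡 4) q)
    (hV : ContMDiffOn (𝓡 4) (𝓡 4).tangent ∞ (fun q => (⟨q, V q⟩ : TangentBundle (𝓡 4) M)) U) :
    Derivation ℝ (smoothFunctions U) (smoothFunctions U) := by
  have hd : ∀ (f : smoothFunctions U) (q : U),
      MDifferentiableAt (𝓡 4) 𝓘(ℝ, ℝ) (extendSmooth f) (q : M) := fun f q =>
    mdifferentiableAt_of_contMDiffOn U.2 (contMDiffOn_extendSmooth f) q.2
  have hc : ∀ (F G : M → ℝ) (q : U), (∀ r : U, F r = G r) →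
      diffReal F (q : M) (V q) = diffReal G (q : M) (V q) := fun F G q h => by
    rw [diffReal_congr (Filter.eventuallyEq_of_mem (U.2.mem_nhds q.2) fun r hr => h ⟨r, hr⟩)]
  refine Derivation.mk'
    { toFun := fun f => toSmooth (fun q => diffReal (extendSmooth f) q (V q))
        (contMDiffOn_diffReal_apply (contMDiffOn_extendSmooth f) hV)
      map_add' := fun f g => smooth_ext fun q => ?_
      map_smul' := fun c f => smooth_ext fun q => ?_ } fun f g => smooth_ext fun q => ?_
  · rw [map_add, evalSmooth_toSmooth, evalSmooth_toSmooth, evalSmooth_toSmooth,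
      ← diffReal_add (hd f q) (hd g q)]
    exact hc _ _ q fun r => by simp only [extendSmooth_apply, map_add]
  · rw [RingHom.id_apply, map_smul, evalSmooth_toSmooth, evalSmooth_toSmooth, smul_eq_mul]
    have h1 := diffReal_mul (f := fun _ => c) mdifferentiableAt_const (hd f q) (V q)
    rw [diffReal_const, mul_zero, add_zero] at h1
    rw [← h1]
    exact hc _ _ q fun r => by simp only [extendSmooth_apply, map_smul, smul_eq_mul]
  · simp only [smul_eq_mul, map_add, map_mul, LinearMap.coe_mk, AddHom.coe_mk]
    rw [evalSmooth_toSmooth, evalSmooth_toSmooth, evalSmooth_toSmooth, ← extendSmooth_apply,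
      ← extendSmooth_apply, ← diffReal_mul (hd f q) (hd g q)]
    exact hc _ _ q fun r => by simp only [extendSmooth_apply, map_mul]

theorem fieldDerivation_toSmooth {V : (q : M) → TangentSpace (𝓡 4) q}
    (hV : ContMDiffOn (𝓡 4) (𝓡 4).tangent ∞ (fun q => (⟨q, V q⟩ : TangentBundle (𝓡 4) M)) U)
    (F : M → ℝ) (hF : ContMDiffOn (𝓡 4) 𝓘(ℝ, ℝ) ∞ F U) :
    fieldDerivation V hV (toSmooth F hF) =
      toSmooth (fun q => diffReal F q (V q)) (contMDiffOn_diffReal_apply hF hV) := by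
  refine smooth_ext fun q => ?_
  change diffReal (extendSmooth (toSmooth F hF)) (q : M) (V q) = diffReal F (q : M) (V q)
  rw [diffReal_congr (Filter.eventuallyEq_of_mem (U.2.mem_nhds q.2)
    fun r hr => extendSmooth_apply (toSmooth F hF) ⟨r, hr⟩)]

end SmoothFunctions
end

/-! ### Linear algebra of pseudo-orthonormal frames in the tangent spaces. -/

noncomputable section

section Frame

variable {V : Type*} [AddCommGroup V] [Module ℝ V] {B : LinearMap.BilinForm ℝ V}
  {η : Fin 4 → Fin 4 → ℝ} {e : Fin 4 → V}

/-- Pairing a linear relation with each frame vector shows that its coefficients are annihilated by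
`η`, which is invertible. -/
theorem frame_linearIndependent (hsq : ∀ i j, ∑ k, η i k * η k j = if i = j then 1 else 0)
    (hB : ∀ i j, B (e i) (e j) = η i j) : LinearIndependent ℝ e := by
  rw [Fintype.linearIndependent_iff]
  intro c hc i
  have h1 : ∀ k, ∑ j, c j * η j k = 0 := by
    intro k
    have := congrArg (fun v => B v (e k)) hc
    simpa only [map_sum, map_smul, LinearMap.sum_apply, LinearMap.smul_apply, hB, smul_eq_mul,
      map_zero, LinearMap.zero_apply] using this
  calc c i = ∑ j, c j * ∑ k, η j k * η k i := by simp [hsq]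
    _ = ∑ k, (∑ j, c j * η j k) * η k i := by
      simp only [Finset.mul_sum, Finset.sum_mul, mul_assoc]
      rw [Finset.sum_comm]
    _ = 0 := by simp [h1]

variable (hd : Module.finrank ℝ V = 4)
  (hsq : ∀ i j, ∑ k, η i k * η k j = if i = j then 1 else 0)
  (hB : ∀ i j, B (e i) (e j) = η i j)

/-- A pseudo-orthonormal frame of a four-dimensional space is a basis. -/
def frameBasis : Module.Basis (Fin 4) ℝ V :=
  basisOfLinearIndependentOfCardEqFinrank (frame_linearIndependent hsq hB) (by simp [hd])

theorem frameBasis_apply (i : Fin 4) : frameBasis hd hsq hB i = e i := by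
  simp [frameBasis]

theorem frameBasis_repr (hsymm : ∀ i j, η i j = η j i) (v : V) (k : Fin 4) :
    (frameBasis hd hsq hB).repr v k = ∑ l, η k l * B v (e l) := by
  have h1 : ∀ l, B v (e l) = ∑ j, (frameBasis hd hsq hB).repr v j * η j l := by
    intro l
    conv_lhs => rw [← (frameBasis hd hsq hB).sum_repr v]
    simp only [map_sum, map_smul, LinearMap.sum_apply, LinearMap.smul_apply, frameBasis_apply, hB,
      smul_eq_mul]
  simp only [h1, Finset.mul_sum]
  rw [Finset.sum_comm]
  have h2 : ∀ j, ∑ l, η k l * ((frameBasis hd hsq hB).repr v j * η j l) =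
      (frameBasis hd hsq hB).repr v j * if k = j then 1 else 0 := by
    intro j
    rw [← hsq, Finset.mul_sum]
    refine Finset.sum_congr rfl fun l _ => ?_
    rw [hsymm j l]
    ring
  simp [h2]

theorem frame_expand (hd : Module.finrank ℝ V = 4)
    (hsq : ∀ i j, ∑ k, η i k * η k j = if i = j then 1 else 0)
    (hB : ∀ i j, B (e i) (e j) = η i j) (hsymm : ∀ i j, η i j = η j i) (v : V) :
    v = ∑ k, (∑ l, η k l * B v (e l)) • e k := by
  conv_lhs => rw [← (frameBasis hd hsq hB).sum_repr v]
  simp only [frameBasis_repr hd hsq hB hsymm, frameBasis_apply]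

theorem frame_nondegenerate (hd : Module.finrank ℝ V = 4)
    (hsq : ∀ i j, ∑ k, η i k * η k j = if i = j then 1 else 0)
    (hB : ∀ i j, B (e i) (e j) = η i j) (hsymm : ∀ i j, η i j = η j i) (hs : B.IsSymm) :
    B.Nondegenerate := by
  have h1 : B.SeparatingLeft := fun v hv => by
    rw [frame_expand hd hsq hB hsymm v]
    simp [hv]
  refine ⟨h1, fun v hv => h1 v fun w => ?_⟩
  rw [hs.eq]
  exact hv w

theorem frame_trace (hd : Module.finrank ℝ V = 4)
    (hsq : ∀ i j, ∑ k, η i k * η k j = if i = j then 1 else 0)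
    (hB : ∀ i j, B (e i) (e j) = η i j) (hsymm : ∀ i j, η i j = η j i) (T : V →ₗ[ℝ] V) :
    LinearMap.trace ℝ V T = ∑ i, ∑ j, η i j * B (T (e i)) (e j) := by
  rw [LinearMap.trace_eq_matrix_trace ℝ (frameBasis hd hsq hB), Matrix.trace]
  refine Finset.sum_congr rfl fun i _ => ?_
  rw [Matrix.diag_apply, LinearMap.toMatrix_apply, frameBasis_repr hd hsq hB hsymm,
    frameBasis_apply]

end Frame

theorem pseudoMetric_symm (σ : ℝ) (i j : Fin 4) : pseudoMetric σ i j = pseudoMetric σ j i := by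
  fin_cases i <;> fin_cases j <;> rfl

theorem pseudoMetric_sq {σ : ℝ} (hσ : σ = 1 ∨ σ = -1) (i j : Fin 4) :
    ∑ k, pseudoMetric σ i k * pseudoMetric σ k j = if i = j then 1 else 0 := by
  have h : σ * σ = 1 := by rcases hσ with rfl | rfl <;> norm_num
  rw [Fin.sum_univ_four]
  fin_cases i <;> fin_cases j <;> simp [pseudoMetric, h]

section Hypersurface

variable {M : Type*} [TopologicalSpace M] [ChartedSpace (EuclideanSpace ℝ (Fin 4)) M]

theorem minkowski_apply (u v : E51) :
    minkowski u v = minkowskiForm (fun m => u m) (fun m => v m) := rfl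

theorem inducedMetric_apply (x : M → E51) (q : M) (u v : TangentSpace (𝓡 4) q) :
    inducedMetric x q u v = minkowski (diffVec x q u) (diffVec x q v) := rfl

theorem inducedMetric_isSymm (x : M → E51) (q : M) : (inducedMetric x q).IsSymm :=
  ⟨fun u v => by
    simp only [inducedMetric_apply, minkowski_apply]
    exact minkowskiForm_comm _ _⟩

theorem finrank_tangentSpace (q : M) : Module.finrank ℝ (TangentSpace (𝓡 4) q) = 4 :=
  finrank_euclideanSpace_fin (𝕜 := ℝ) (n := 4)

theorem diffVec_apply {F : M → E51} {q : M} (hF : MDifferentiableAt (𝓡 4) 𝓘(ℝ, E51) F q)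
    (v : TangentSpace (𝓡 4) q) (m : Fin 5) :
    diffVec F q v m = diffReal (fun r => F r m) q v := by
  have h1 : MDifferentiableAt 𝓘(ℝ, E51) 𝓘(ℝ, ℝ)
      (EuclideanSpace.proj (𝕜 := ℝ) m : E51 →L[ℝ] ℝ) (F q) :=
    (ContinuousLinearMap.differentiableAt _).mdifferentiableAt
  have h2 := mfderiv_comp q h1 hF
  rw [mfderiv_eq_fderiv, ContinuousLinearMap.fderiv] at h2
  exact (congrArg (fun L : EuclideanSpace ℝ (Fin 4) →L[ℝ] ℝ => L v) h2).symm

theorem inducedMetric_sharp {x : M → E51} {q : M} (h : (inducedMetric x q).Nondegenerate)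
    (φ : Module.Dual ℝ (TangentSpace (𝓡 4) q)) (u : TangentSpace (𝓡 4) q) :
    inducedMetric x q (sharp x q φ) u = φ u := by
  rw [sharp, dif_pos h]
  exact LinearMap.BilinForm.apply_toDual_symm_apply φ u

theorem inducedMetric_tangentialPart {x : M → E51} {q : M}
    (h : (inducedMetric x q).Nondegenerate) (w : E51) (u : TangentSpace (𝓡 4) q) :
    inducedMetric x q (tangentialPart x q w) u = minkowski w (diffVec x q u) :=
  inducedMetric_sharp h _ u

theorem contMDiffOn_coord {F : M → E51} {U : Set M} (hF : ContMDiffOn (𝓡 4) 𝓘(ℝ, E51) ∞ F U)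
    (m : Fin 5) : ContMDiffOn (𝓡 4) 𝓘(ℝ, ℝ) ∞ (fun q => F q m) U :=
  (EuclideanSpace.proj (𝕜 := ℝ) m : E51 →L[ℝ] ℝ).contMDiff.comp_contMDiffOn hF

/-- The coordinates of a smooth map, as smooth functions on `U`. -/
def smoothCoords {U : TopologicalSpace.Opens M} (F : M → E51)
    (hF : ContMDiffOn (𝓡 4) 𝓘(ℝ, E51) ∞ F U) (m : Fin 5) : smoothFunctions U :=
  toSmooth (fun q => F q m) (contMDiffOn_coord hF m)

theorem AlgHom.map_minkowskiForm {A : Type*} [CommRing A] [Algebra ℝ A] (φ : A →ₐ[ℝ] ℝ)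
    (u v : Fin 5 → A) :
    φ (minkowskiForm u v) = minkowskiForm (fun m => φ (u m)) (fun m => φ (v m)) := by
  simp only [minkowskiForm, map_add, map_neg, map_mul]

variable [IsManifold (𝓡 4) ∞ M] {U : TopologicalSpace.Opens M} {x N : M → E51} {σ : ℝ}
  {e : Fin 4 → (q : M) → TangentSpace (𝓡 4) q}

theorem evalSmooth_fieldDerivation_coords {V : (q : M) → TangentSpace (𝓡 4) q}
    (hV : ContMDiffOn (𝓡 4) (𝓡 4).tangent ∞ (fun q => (⟨q, V q⟩ : TangentBundle (𝓡 4) M)) U)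
    {F : M → E51} (hF : ContMDiffOn (𝓡 4) 𝓘(ℝ, E51) ∞ F U) (q : U) (m : Fin 5) :
    evalSmooth q (fieldDerivation V hV (smoothCoords F hF m)) = diffVec F (q : M) (V q) m := by
  rw [smoothCoords, fieldDerivation_toSmooth, evalSmooth_toSmooth,
    diffVec_apply (mdifferentiableAt_of_contMDiffOn U.2 hF q.2)]

namespace IsPseudoOrthonormalFrameOn

theorem metric_eq (he : IsPseudoOrthonormalFrameOn x U σ e) (q : U) (i j : Fin 4) :
    inducedMetric x (q : M) (e i q) (e j q) = pseudoMetric σ i j := by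
  rw [he.metric q q.2]
  fin_cases i <;> fin_cases j <;> rfl

theorem nondegenerate (he : IsPseudoOrthonormalFrameOn x U σ e) (q : U) :
    (inducedMetric x (q : M)).Nondegenerate :=
  frame_nondegenerate (finrank_tangentSpace _) (pseudoMetric_sq he.sign) (he.metric_eq q)
    (pseudoMetric_symm σ) (inducedMetric_isSymm x q)

theorem expand (he : IsPseudoOrthonormalFrameOn x U σ e) (q : U) (v : TangentSpace (𝓡 4) (q : M)) :
    v = ∑ k, (∑ l, pseudoMetric σ k l * inducedMetric x (q : M) v (e l q)) • e k q :=
  frame_expand (finrank_tangentSpace _) (pseudoMetric_sq he.sign) (he.metric_eq q)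
    (pseudoMetric_symm σ) v

theorem trace (he : IsPseudoOrthonormalFrameOn x U σ e) (q : U)
    (T : TangentSpace (𝓡 4) (q : M) →ₗ[ℝ] TangentSpace (𝓡 4) (q : M)) :
    LinearMap.trace ℝ (TangentSpace (𝓡 4) (q : M)) T =
      ∑ i, ∑ j, pseudoMetric σ i j * inducedMetric x (q : M) (T (e i q)) (e j q) :=
  frame_trace (finrank_tangentSpace _) (pseudoMetric_sq he.sign) (he.metric_eq q)
    (pseudoMetric_symm σ) T

/-- The derivations that the fields of the frame define. -/
def deriv (he : IsPseudoOrthonormalFrameOn x U σ e) (i : Fin 4) :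
    Derivation ℝ (smoothFunctions U) (smoothFunctions U) :=
  fieldDerivation (e i) (he.smooth i)

end IsPseudoOrthonormalFrameOn

end Hypersurface
end

/-! ### Geometric frame fields as adapted frames of the function algebra. -/

noncomputable section

section AdaptedFrame

variable {M : Type*} [TopologicalSpace M] [ChartedSpace (EuclideanSpace ℝ (Fin 4)) M]
  [IsManifold (𝓡 4) ∞ M] {U : TopologicalSpace.Opens M} {x N : M → E51} {σ : ℝ}
  {e : Fin 4 → (q : M) → TangentSpace (𝓡 4) q}

namespace IsPseudoOrthonormalFrameOn

theorem evalSmooth_deriv_coords (he : IsPseudoOrthonormalFrameOn x U σ e) {F : M → E51}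
    (hF : ContMDiffOn (𝓡 4) 𝓘(ℝ, E51) ∞ F U) (q : U) (i : Fin 4) (m : Fin 5) :
    evalSmooth q (he.deriv i (smoothCoords F hF m)) = diffVec F (q : M) (e i q) m :=
  evalSmooth_fieldDerivation_coords (he.smooth i) hF q m

theorem deriv_toSmooth (he : IsPseudoOrthonormalFrameOn x U σ e) (F : M → ℝ)
    (hF : ContMDiffOn (𝓡 4) 𝓘(ℝ, ℝ) ∞ F U) (i : Fin 4) :
    he.deriv i (toSmooth F hF) =
      toSmooth (fun q => diffReal F q (e i q)) (contMDiffOn_diffReal_apply hF (he.smooth i)) :=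
  fieldDerivation_toSmooth (he.smooth i) F hF

theorem minkowski_diffVec_normal (he : IsPseudoOrthonormalFrameOn x U σ e)
    (hN : IsUnitNormal x N) (q : U) (i : Fin 4) :
    minkowski (diffVec N (q : M) (e i q)) (N q) = 0 := by
  have h1 : minkowskiForm (smoothCoords (U := U) N hN.smooth.contMDiffOn)
      (smoothCoords N hN.smooth.contMDiffOn) = 1 := smooth_ext fun r => by
    rw [AlgHom.map_minkowskiForm, map_one]
    exact hN.unit r
  have h2 := congrArg (he.deriv i) h1
  rw [deriv_minkowskiForm, Derivation.map_one_eq_zero, minkowskiForm_comm (smoothCoords _ _),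
    ← two_mul] at h2
  have h3 := congrArg (evalSmooth q) (eq_zero_of_two_mul h2)
  rw [AlgHom.map_minkowskiForm, map_zero] at h3
  simp only [vecDeriv, evalSmooth_deriv_coords] at h3
  exact h3

/-- The shape operator is defined through the tangential part of `-dN`, so it must be checked that
nothing is lost. The difference `y` is orthogonal to the frame and to `N`, hence zero. -/
theorem diffVec_normal (he : IsPseudoOrthonormalFrameOn x U σ e) (hN : IsUnitNormal x N) (q : U)
    (i : Fin 4) :
    diffVec N (q : M) (e i q) = -diffVec x (q : M) (shapeOperator x N q (e i q)) := by
  obtain ⟨v, hv⟩ : ∃ v, v = e i q := ⟨_, rfl⟩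
  rw [← hv]
  obtain ⟨y, hy⟩ : ∃ y, y = diffVec N (q : M) v + diffVec x (q : M) (shapeOperator x N q v) :=
    ⟨_, rfl⟩
  have h1 : ∀ u, minkowski y (diffVec x (q : M) u) = 0 := by
    intro u
    have h2 := inducedMetric_tangentialPart (he.nondegenerate q) (diffVec N (q : M) v) u
    have h3 : shapeOperator x N (q : M) v = -tangentialPart x (q : M) (diffVec N (q : M) v) := rfl
    rw [hy, map_add, LinearMap.add_apply, ← inducedMetric_apply, h3, map_neg, LinearMap.neg_apply,
      h2, add_neg_cancel]
  have h4 : minkowski y (N q) = 0 := by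
    have h5 := he.minkowski_diffVec_normal hN q i
    rw [← hv] at h5
    have h6 := hN.normal q (shapeOperator x N q v)
    rw [minkowski_apply, minkowskiForm_comm, ← minkowski_apply] at h6
    rw [hy, map_add, LinearMap.add_apply, h5, h6, add_zero]
  have h7 : y = 0 := by
    ext m
    have h8 := minkowskiForm_expand (E := fun i m => diffVec x (q : M) (e i q) m)
      (N := fun m => N q m) (pseudoMetric_symm σ) (pseudoMetric_sq he.sign) (he.metric_eq q)
      (hN.unit q) (fun i => hN.normal q (e i q)) (fun m => y m) m
    simp only [minkowski_apply] at h1 h4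
    simp only [h1, h4, mul_zero, Finset.sum_const_zero, zero_mul, add_zero] at h8
    exact h8
  exact eq_neg_of_add_eq_zero_left (hy.symm.trans h7)

/-- A pseudo-orthonormal frame field on a hypersurface is an adapted frame of the algebra of
smooth functions. -/
theorem isAdaptedFrame (he : IsPseudoOrthonormalFrameOn x U σ e)
    (hx : ContMDiff (𝓡 4) 𝓘(ℝ, E51) ∞ x) (hN : IsUnitNormal x N)
    {S : Fin 4 → Fin 4 → smoothFunctions U}
    (hS : ∀ (q : U) i, shapeOperator x N (q : M) (e i q) = ∑ j, evalSmooth q (S i j) • e j q) :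
    IsAdaptedFrame he.deriv (smoothCoords x hx.contMDiffOn) (smoothCoords N hN.smooth.contMDiffOn)
      (pseudoMetric σ) S where
  symm := pseudoMetric_symm σ
  sq := pseudoMetric_sq he.sign
  metric i j := smooth_ext fun q => by
    rw [AlgHom.map_minkowskiForm, AlgHom.commutes]
    simp only [vecDeriv, evalSmooth_deriv_coords]
    exact he.metric_eq q i j
  unit := smooth_ext fun q => by
    rw [AlgHom.map_minkowskiForm, map_one]
    exact hN.unit q
  normal i := smooth_ext fun q => by
    rw [AlgHom.map_minkowskiForm, map_zero]
    simp only [vecDeriv, evalSmooth_deriv_coords]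
    exact hN.normal q (e i q)
  weingarten i m := smooth_ext fun q => by
    simp only [map_neg, map_sum, map_mul, evalSmooth_deriv_coords]
    rw [he.diffVec_normal hN, hS]
    simp
  torsion i j f := smooth_ext fun q => by
    obtain ⟨F, hF, rfl⟩ := exists_toSmooth f
    -- Applying the bracket vector `w` to the coordinates of `x` computes `dx w`, and pairing with
    -- the frame gives the components of `w`. Torsion-freeness thus comes from the ambient
    -- derivative.
    obtain ⟨w, hw⟩ := exists_bracket U.2 (he.smooth i) (he.smooth j) q.2
    have h1 : ∀ G (hG : ContMDiffOn (𝓡 4) 𝓘(ℝ, ℝ) ∞ G U),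
        evalSmooth q (he.deriv i (he.deriv j (toSmooth G hG)) -
          he.deriv j (he.deriv i (toSmooth G hG))) = diffReal G (q : M) w := by
      intro G hG
      simp only [deriv_toSmooth, map_sub, evalSmooth_toSmooth]
      exact hw G hG
    have h2 : ∀ l, inducedMetric x (q : M) w (e l q) =
        evalSmooth q (connCoeff he.deriv (smoothCoords x hx.contMDiffOn) i j l -
          connCoeff he.deriv (smoothCoords x hx.contMDiffOn) j i l) := by
      intro l
      rw [connCoeff, connCoeff, ← minkowskiForm_sub_left, AlgHom.map_minkowskiForm,
        inducedMetric_apply, minkowski_apply]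
      simp only [vecDeriv, evalSmooth_deriv_coords]
      congr 1
      funext m
      rw [smoothCoords, h1, diffVec_apply (hx.mdifferentiableAt (by simp))]
    rw [h1]
    conv_lhs => rw [he.expand q w]
    simp only [map_sum, map_mul, AlgHom.commutes, map_smul, smul_eq_mul, h2, deriv_toSmooth,
      evalSmooth_toSmooth]
    rfl

end IsPseudoOrthonormalFrameOn

end AdaptedFrame
end

/-! ### Agreement of the geometric Laplacian and mean curvature with the frame formulas. -/

noncomputable section

section Laplace

/-- By the product rule `⟨Dᵢ∇f, eⱼ⟩ = DᵢDⱼf - ⟨∇f, Dᵢeⱼ⟩`, so the trace of the Hessian is the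
divergence of the gradient. -/
theorem IsAdaptedFrame.frameLaplace_eq_divergence {A : Type*} [CommRing A] [Algebra ℝ A]
    {D : Fin 4 → Derivation ℝ A A} {x N : Fin 5 → A} {η : Fin 4 → Fin 4 → ℝ}
    {S : Fin 4 → Fin 4 → A} (h : IsAdaptedFrame D x N η S) (f : A) :
    frameLaplace D x η f = -∑ i, ∑ j, algebraMap ℝ A (η i j) *
      minkowskiForm (vecDeriv (D i) fun m => ∑ k, (∑ l, algebraMap ℝ A (η k l) * D l f) * D k (x m))
        (vecDeriv (D j) x) := by
  rw [frameLaplace]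
  congr 1
  refine Finset.sum_congr rfl fun i _ => Finset.sum_congr rfl fun j _ => ?_
  congr 1
  obtain ⟨a, ha⟩ : ∃ a : Fin 4 → A, a = fun k => ∑ l, algebraMap ℝ A (η k l) * D l f := ⟨_, rfl⟩
  have h1 := deriv_minkowskiForm (D i) (fun m => ∑ k, a k * D k (x m)) (vecDeriv (D j) x)
  have h2 : ∀ w, minkowskiForm (fun m => ∑ k, a k * D k (x m)) w =
      ∑ k, a k * minkowskiForm (vecDeriv (D k) x) w := fun w => minkowskiForm_sum_left _ _ _ _
  have h3 : ∑ k, a k * minkowskiForm (vecDeriv (D k) x) (vecDeriv (D j) x) = D j f := by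
    simp only [h.metric, ha, Finset.sum_mul]
    rw [Finset.sum_comm]
    have h4 : ∀ l, ∑ k, algebraMap ℝ A (η k l) * D l f * algebraMap ℝ A (η k j) =
        D l f * if l = j then 1 else 0 := by
      intro l
      have h5 := congrArg (algebraMap ℝ A) (h.sq l j)
      rw [map_sum, apply_ite (algebraMap ℝ A), map_one, map_zero] at h5
      rw [← h5, Finset.mul_sum]
      refine Finset.sum_congr rfl fun k _ => ?_
      rw [h.symm k l, map_mul]
      ring
    simp [h4]
  have h6 : ∑ k, a k * minkowskiForm (vecDeriv (D k) x) (vecDeriv (D i) (vecDeriv (D j) x)) =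
      ∑ k, (∑ l, algebraMap ℝ A (η k l) * connCoeff D x i j l) * D k f := by
    simp only [ha, Finset.sum_mul, minkowskiForm_comm (vecDeriv (D _) x) (vecDeriv _ _)]
    rw [Finset.sum_comm]
    refine Finset.sum_congr rfl fun k _ => Finset.sum_congr rfl fun l _ => ?_
    rw [h.symm k l, connCoeff]
    ring
  rw [h2, h2, h3, h6, ha] at h1
  rw [h1, add_sub_cancel_right]

variable {M : Type*} [TopologicalSpace M] [ChartedSpace (EuclideanSpace ℝ (Fin 4)) M]

theorem diffVec_congr {F G : M → E51} {p : M} (h : F =ᶠ[nhds p] G) :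
    diffVec F p = diffVec G p := by
  have := h.mfderiv_eq (I := 𝓡 4) (I' := 𝓘(ℝ, E51))
  ext v : 1
  exact congrArg (fun L : EuclideanSpace ℝ (Fin 4) →L[ℝ] E51 => L v) this

variable [IsManifold (𝓡 4) ∞ M] {U : TopologicalSpace.Opens M} {x N : M → E51} {σ : ℝ}
  {e : Fin 4 → (q : M) → TangentSpace (𝓡 4) q}

namespace IsPseudoOrthonormalFrameOn

theorem metricGradient_eq (he : IsPseudoOrthonormalFrameOn x U σ e) (f : M → ℝ) (q : U) :
    metricGradient x f (q : M) =
      ∑ k, (∑ l, pseudoMetric σ k l * diffReal f (q : M) (e l q)) • e k q := by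
  rw [he.expand q (metricGradient x f q)]
  simp only [metricGradient, inducedMetric_sharp (he.nondegenerate q)]

theorem laplace_eq (he : IsPseudoOrthonormalFrameOn x U σ e)
    (hx : ContMDiff (𝓡 4) 𝓘(ℝ, E51) ∞ x) {S : Fin 4 → Fin 4 → smoothFunctions U}
    {n : Fin 5 → smoothFunctions U}
    (h : IsAdaptedFrame he.deriv (smoothCoords x hx.contMDiffOn) n (pseudoMetric σ) S)
    {f : M → ℝ} (hf : ContMDiffOn (𝓡 4) 𝓘(ℝ, ℝ) ∞ f U) (q : U) :
    laplace x f q = evalSmooth q (frameLaplace he.deriv (smoothCoords x hx.contMDiffOn)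
      (pseudoMetric σ) (toSmooth f hf)) := by
  -- This is `dx(∇f)` written in the frame. It is known to agree with the gradient only on `U`,
  -- which suffices for derivatives there.
  obtain ⟨G, hG⟩ : ∃ G : M → E51, G = fun r =>
    ∑ k, (∑ l, pseudoMetric σ k l * diffReal f r (e l r)) • diffVec x r (e k r) := ⟨_, rfl⟩
  have hGs : ContMDiffOn (𝓡 4) 𝓘(ℝ, E51) ∞ G U := by
    rw [hG]
    refine contMDiffOn_finsetSum fun k _ => ?_
    have h1 : ContMDiffOn (𝓡 4) 𝓘(ℝ, ℝ) ∞
        (fun r => ∑ l, pseudoMetric σ k l * diffReal f r (e l r)) U :=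
      contMDiffOn_finsetSum fun l _ =>
        contMDiffOn_const.mul (contMDiffOn_diffReal_apply hf (he.smooth l))
    exact h1.smul (contMDiffOn_mvfderiv_apply U.2 hx.contMDiffOn (he.smooth k))
  have h1 : diffVec (fun r => diffVec x r (metricGradient x f r)) (q : M) = diffVec G (q : M) := by
    refine diffVec_congr (Filter.eventuallyEq_of_mem (U.2.mem_nhds q.2) fun r hr => ?_)
    rw [he.metricGradient_eq f ⟨r, hr⟩, hG]
    simp only [map_sum, map_smul]
  have h2 : smoothCoords G hGs = fun m => ∑ k, (∑ l, algebraMap ℝ (smoothFunctions U)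
      (pseudoMetric σ k l) * he.deriv l (toSmooth f hf)) *
        he.deriv k (smoothCoords x hx.contMDiffOn m) := by
    funext m
    refine smooth_ext fun r => ?_
    simp only [map_sum, map_mul, AlgHom.commutes, evalSmooth_deriv_coords, deriv_toSmooth,
      evalSmooth_toSmooth]
    rw [smoothCoords, evalSmooth_toSmooth, hG]
    simp
  rw [h.frameLaplace_eq_divergence, laplace, divergence, he.trace q, ← h2]
  simp only [map_neg, map_sum, map_mul, AlgHom.commutes, AlgHom.map_minkowskiForm, vecDeriv,
    evalSmooth_deriv_coords]
  congr 1
  refine Finset.sum_congr rfl fun i _ => Finset.sum_congr rfl fun j _ => ?_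
  rw [covDeriv, LinearMap.comp_apply, inducedMetric_tangentialPart (he.nondegenerate q), h1]
  rfl

theorem meanCurvature_eq (he : IsPseudoOrthonormalFrameOn x U σ e)
    {S : Fin 4 → Fin 4 → smoothFunctions U}
    (hS : ∀ (q : U) i, shapeOperator x N (q : M) (e i q) = ∑ j, evalSmooth q (S i j) • e j q)
    (q : U) : meanCurvature x N q = evalSmooth q (∑ i, S i i) := by
  rw [meanCurvature, he.trace q, map_sum]
  refine Finset.sum_congr rfl fun i _ => ?_
  simp only [hS, map_sum, map_smul, LinearMap.sum_apply, LinearMap.smul_apply, he.metric_eq,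
    smul_eq_mul, Finset.mul_sum]
  rw [Finset.sum_comm]
  have h1 : ∀ k, ∑ j, pseudoMetric σ i j * (evalSmooth q (S i k) * pseudoMetric σ k j) =
      evalSmooth q (S i k) * if i = k then 1 else 0 := by
    intro k
    rw [← pseudoMetric_sq he.sign i k, Finset.mul_sum]
    refine Finset.sum_congr rfl fun j _ => ?_
    rw [pseudoMetric_symm σ k j]
    ring
  simp [h1]

end IsPseudoOrthonormalFrameOn

end Laplace
end

/-! ### Hypersurfaces whose shape operator has a Jordan block on an open set. -/

noncomputable section

section JordanHypersurface

variable {M : Type*} [TopologicalSpace M] [ChartedSpace (EuclideanSpace ℝ (Fin 4)) M]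
  [IsManifold (𝓡 4) ∞ M] {U V : TopologicalSpace.Opens M} {x N : M → E51} {k₁ k₃ k₄ : M → ℝ}
  {σ : ℝ} {e : Fin 4 → (q : M) → TangentSpace (𝓡 4) q}

/-- On `U` the shape operator of the hypersurface `x` has one Jordan block of size two and two
simple eigenvalues in the pseudo-orthonormal frame `e`. -/
structure IsJordanHypersurfaceOn (x N : M → E51) (k₁ k₃ k₄ : M → ℝ) (U : TopologicalSpace.Opens M)
    (σ : ℝ) (e : Fin 4 → (q : M) → TangentSpace (𝓡 4) q) : Prop where
  smooth : ContMDiff (𝓡 4) 𝓘(ℝ, E51) ∞ x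
  normal : IsUnitNormal x N
  smooth₁ : ContMDiff (𝓡 4) 𝓘(ℝ, ℝ) ∞ k₁
  smooth₃ : ContMDiff (𝓡 4) 𝓘(ℝ, ℝ) ∞ k₃
  smooth₄ : ContMDiff (𝓡 4) 𝓘(ℝ, ℝ) ∞ k₄
  frame : IsPseudoOrthonormalFrameOn x U σ e
  shape₀ : ∀ q ∈ U, shapeOperator x N q (e 0 q) = k₁ q • e 0 q
  shape₁ : ∀ q ∈ U, shapeOperator x N q (e 1 q) = e 0 q + k₁ q • e 1 q
  shape₂ : ∀ q ∈ U, shapeOperator x N q (e 2 q) = k₃ q • e 2 q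
  shape₃ : ∀ q ∈ U, shapeOperator x N q (e 3 q) = k₄ q • e 3 q

theorem IsPseudoOrthonormalFrameOn.mono {U V : Set M} (he : IsPseudoOrthonormalFrameOn x U σ e)
    (h : V ⊆ U) : IsPseudoOrthonormalFrameOn x V σ e where
  smooth i := (he.smooth i).mono h
  sign := he.sign
  metric q hq := he.metric q (h hq)

theorem Derivation.map_algebraMap_mul {A : Type*} [CommRing A] [Algebra ℝ A]
    (D : Derivation ℝ A A) (c : ℝ) (f : A) :
    D (algebraMap ℝ A c * f) = algebraMap ℝ A c * D f := by
  rw [Derivation.leibniz, Derivation.map_algebraMap, smul_zero, add_zero, smul_eq_mul]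

theorem frameLaplace_algebraMap_mul {A : Type*} [CommRing A] [Algebra ℝ A]
    (D : Fin 4 → Derivation ℝ A A) (y : Fin 5 → A) (η : Fin 4 → Fin 4 → ℝ) (c : ℝ) (f : A) :
    frameLaplace D y η (algebraMap ℝ A c * f) = algebraMap ℝ A c * frameLaplace D y η f := by
  simp only [frameLaplace, Derivation.map_algebraMap_mul, mul_neg, Finset.mul_sum, mul_sub]
  simp only [mul_left_comm (algebraMap ℝ A c)]

theorem frameLaplace_zero_of_deriv {A : Type*} [CommRing A] [Algebra ℝ A]
    (D : Fin 4 → Derivation ℝ A A) (y : Fin 5 → A) (η : Fin 4 → Fin 4 → ℝ) {f : A}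
    (hf : ∀ i, D i f = 0) : frameLaplace D y η f = 0 := by
  simp [frameLaplace, hf]

namespace IsJordanHypersurfaceOn

theorem mono (h : IsJordanHypersurfaceOn x N k₁ k₃ k₄ U σ e) (hV : V ≤ U) :
    IsJordanHypersurfaceOn x N k₁ k₃ k₄ V σ e :=
  { h with
    frame := h.frame.mono hV
    shape₀ := fun q hq => h.shape₀ q (hV hq)
    shape₁ := fun q hq => h.shape₁ q (hV hq)
    shape₂ := fun q hq => h.shape₂ q (hV hq)
    shape₃ := fun q hq => h.shape₃ q (hV hq) }

/-- The two simple eigenvalues can be interchanged. -/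
theorem swap (h : IsJordanHypersurfaceOn x N k₁ k₃ k₄ U σ e) :
    IsJordanHypersurfaceOn x N k₁ k₄ k₃ U σ (fun i => e (Equiv.swap 2 3 i)) where
  smooth := h.smooth
  normal := h.normal
  smooth₁ := h.smooth₁
  smooth₃ := h.smooth₄
  smooth₄ := h.smooth₃
  frame :=
    { smooth := fun i => h.frame.smooth _
      sign := h.frame.sign
      metric := fun q hq i j => (h.frame.metric q hq _ _).trans (by
        fin_cases i <;> fin_cases j <;> rfl) }
  shape₀ := h.shape₀
  shape₁ := h.shape₁
  shape₂ := h.shape₃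
  shape₃ := h.shape₂

/-- The double eigenvalue as a smooth function on `U`. -/
def c₁ (h : IsJordanHypersurfaceOn x N k₁ k₃ k₄ U σ e) : smoothFunctions U :=
  toSmooth k₁ h.smooth₁.contMDiffOn

/-- The first simple eigenvalue as a smooth function on `U`. -/
def c₃ (h : IsJordanHypersurfaceOn x N k₁ k₃ k₄ U σ e) : smoothFunctions U :=
  toSmooth k₃ h.smooth₃.contMDiffOn

/-- The second simple eigenvalue as a smooth function on `U`. -/
def c₄ (h : IsJordanHypersurfaceOn x N k₁ k₃ k₄ U σ e) : smoothFunctions U :=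
  toSmooth k₄ h.smooth₄.contMDiffOn

/-- The coordinates of the position vector as smooth functions on `U`. -/
def pos (h : IsJordanHypersurfaceOn x N k₁ k₃ k₄ U σ e) : Fin 5 → smoothFunctions U :=
  smoothCoords x h.smooth.contMDiffOn

/-- The coordinates of the unit normal as smooth functions on `U`. -/
def nor (h : IsJordanHypersurfaceOn x N k₁ k₃ k₄ U σ e) : Fin 5 → smoothFunctions U :=
  smoothCoords N h.normal.smooth.contMDiffOn

theorem eval_c₁ (h : IsJordanHypersurfaceOn x N k₁ k₃ k₄ U σ e) (q : U) :
    evalSmooth q h.c₁ = k₁ q := rfl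

theorem eval_c₃ (h : IsJordanHypersurfaceOn x N k₁ k₃ k₄ U σ e) (q : U) :
    evalSmooth q h.c₃ = k₃ q := rfl

theorem eval_c₄ (h : IsJordanHypersurfaceOn x N k₁ k₃ k₄ U σ e) (q : U) :
    evalSmooth q h.c₄ = k₄ q := rfl

theorem shape_eq (h : IsJordanHypersurfaceOn x N k₁ k₃ k₄ U σ e) (q : U) (i : Fin 4) :
    shapeOperator x N (q : M) (e i q) =
      ∑ j, evalSmooth q (jordanShape h.c₁ h.c₃ h.c₄ i j) • e j q := by
  rw [Fin.sum_univ_four]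
  fin_cases i
  · simpa [jordanShape, eval_c₁] using h.shape₀ q q.2
  · simpa [jordanShape, eval_c₁] using h.shape₁ q q.2
  · simpa [jordanShape, eval_c₃] using h.shape₂ q q.2
  · simpa [jordanShape, eval_c₄] using h.shape₃ q q.2

theorem isAdaptedFrame (h : IsJordanHypersurfaceOn x N k₁ k₃ k₄ U σ e) :
    IsAdaptedFrame h.frame.deriv h.pos h.nor (pseudoMetric σ) (jordanShape h.c₁ h.c₃ h.c₄) :=
  h.frame.isAdaptedFrame h.smooth h.normal h.shape_eq

theorem sum_jordanShape {A : Type*} [CommRing A] (a b c : A) :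
    ∑ i, jordanShape a b c i i = 2 * a + b + c := by
  simp only [Fin.sum_univ_four, jordanShape, Matrix.cons_val]
  ring

theorem meanCurvature_eq (h : IsJordanHypersurfaceOn x N k₁ k₃ k₄ U σ e) {q : M} (hq : q ∈ U) :
    meanCurvature x N q = 2 * k₁ q + k₃ q + k₄ q := by
  rw [h.frame.meanCurvature_eq h.shape_eq ⟨q, hq⟩, sum_jordanShape]
  simp [AlgHom.map_ofNat_eq, eval_c₁, eval_c₃, eval_c₄]

theorem laplace_eq (h : IsJordanHypersurfaceOn x N k₁ k₃ k₄ U σ e) {f : M → ℝ}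
    (hf : ContMDiffOn (𝓡 4) 𝓘(ℝ, ℝ) ∞ f U) (q : U) :
    laplace x f q =
      evalSmooth q (frameLaplace h.frame.deriv h.pos (pseudoMetric σ) (toSmooth f hf)) :=
  h.frame.laplace_eq h.smooth h.isAdaptedFrame hf q

theorem laplace_position (h : IsJordanHypersurfaceOn x N k₁ k₃ k₄ U σ e) {q : M} (hq : q ∈ U)
    (m : Fin 5) : laplace x (fun r => x r m) q = -((2 * k₁ q + k₃ q + k₄ q) * N q m) := by
  rw [h.laplace_eq (contMDiffOn_coord h.smooth.contMDiffOn m) ⟨q, hq⟩]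
  have := h.isAdaptedFrame.frameLaplace_position m
  rw [pos, smoothCoords] at this
  rw [pos, this, sum_jordanShape]
  simp [AlgHom.map_ofNat_eq, eval_c₁, eval_c₃, eval_c₄, nor, smoothCoords]

theorem laplace_zero (h : IsJordanHypersurfaceOn x N k₁ k₃ k₄ U σ e) {q : M} (hq : q ∈ U) :
    laplace x (fun _ => 0) q = 0 := by
  rw [h.laplace_eq contMDiffOn_const ⟨q, hq⟩, frameLaplace_zero_of_deriv, map_zero]
  intro i
  exact map_zero (h.frame.deriv i)

/-- The trace of the shape operator as a smooth function. -/
theorem contMDiff_trace (h : IsJordanHypersurfaceOn x N k₁ k₃ k₄ U σ e) :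
    ContMDiff (𝓡 4) 𝓘(ℝ, ℝ) ∞ fun q => 2 * k₁ q + k₃ q + k₄ q :=
  ((contMDiff_const.mul h.smooth₁).add h.smooth₃).add h.smooth₄

theorem frameLaplace_trace_mul_normal (h : IsJordanHypersurfaceOn x N k₁ k₃ k₄ U σ e)
    (hb : ∀ m, ∀ q ∈ U, laplace x (fun r => -((2 * k₁ r + k₃ r + k₄ r) * N r m)) q = 0)
    (m : Fin 5) : frameLaplace h.frame.deriv h.pos (pseudoMetric σ)
      ((2 * h.c₁ + h.c₃ + h.c₄) * h.nor m) = 0 := by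
  have h1 : ContMDiffOn (𝓡 4) 𝓘(ℝ, ℝ) ∞ (fun r => -((2 * k₁ r + k₃ r + k₄ r) * N r m)) U :=
    (h.contMDiff_trace.contMDiffOn.mul (contMDiffOn_coord h.normal.smooth.contMDiffOn m)).neg
  have h2 : toSmooth _ h1 = -((2 * h.c₁ + h.c₃ + h.c₄) * h.nor m) := smooth_ext fun q => by
    simp [AlgHom.map_ofNat_eq, eval_c₁, eval_c₃, eval_c₄, nor, smoothCoords]
  have h3 : (2 * h.c₁ + h.c₃ + h.c₄) * h.nor m =
      algebraMap ℝ (smoothFunctions U) (-1) * toSmooth _ h1 := by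
    rw [h2, map_neg, map_one]
    ring
  rw [h3, frameLaplace_algebraMap_mul, mul_eq_zero_of_right]
  refine smooth_ext fun q => ?_
  rw [← h.laplace_eq, map_zero]
  exact hb m q q.2

theorem eval_deriv_trace (h : IsJordanHypersurfaceOn x N k₁ k₃ k₄ U σ e) (q : U) (i : Fin 4) :
    evalSmooth q (h.frame.deriv i (2 * h.c₁ + h.c₃ + h.c₄)) =
      diffReal (fun r => 2 * k₁ r + k₃ r + k₄ r) (q : M) (e i q) := by
  have h1 : 2 * h.c₁ + h.c₃ + h.c₄ = toSmooth _ (h.contMDiff_trace.contMDiffOn) :=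
    smooth_ext fun q => by simp [AlgHom.map_ofNat_eq, eval_c₁, eval_c₃, eval_c₄]
  rw [h1, h.frame.deriv_toSmooth, evalSmooth_toSmooth]

end IsJordanHypersurfaceOn

end JordanHypersurface
end

/-! ### Nonexistence of a biharmonic example with nowhere vanishing mean curvature. -/

noncomputable section

section BiharmonicJordan

theorem trace_swap {M : Type*} (k₁ k₃ k₄ : M → ℝ) (r : M) :
    2 * k₁ r + k₄ r + k₃ r = 2 * k₁ r + k₃ r + k₄ r :=
  add_right_comm _ _ _

variable {M : Type*} [TopologicalSpace M] [ChartedSpace (EuclideanSpace ℝ (Fin 4)) M]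
  [IsManifold (𝓡 4) ∞ M] {U V : TopologicalSpace.Opens M} {x N : M → E51} {k₁ k₃ k₄ : M → ℝ}
  {σ : ℝ} {e : Fin 4 → (q : M) → TangentSpace (𝓡 4) q}

/-- The hypersurface is biharmonic with nowhere vanishing mean curvature on `U`, and its principal
curvatures are distinct there. -/
structure IsProperBiharmonicJordanOn (x N : M → E51) (k₁ k₃ k₄ : M → ℝ)
    (U : TopologicalSpace.Opens M) (σ : ℝ) (e : Fin 4 → (q : M) → TangentSpace (𝓡 4) q) : Prop
    extends IsJordanHypersurfaceOn x N k₁ k₃ k₄ U σ e where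
  ne₁₃ : ∀ q ∈ U, k₁ q - k₃ q ≠ 0
  ne₁₄ : ∀ q ∈ U, k₁ q - k₄ q ≠ 0
  ne₃₄ : ∀ q ∈ U, k₃ q - k₄ q ≠ 0
  trace_ne : ∀ q ∈ U, 2 * k₁ q + k₃ q + k₄ q ≠ 0
  biharmonic : ∀ m, ∀ q ∈ U, laplace x (fun r => -((2 * k₁ r + k₃ r + k₄ r) * N r m)) q = 0

/-- The derivative of the mean curvature in the direction of the frame. -/
def traceDeriv (k₁ k₃ k₄ : M → ℝ) (e : Fin 4 → (q : M) → TangentSpace (𝓡 4) q) (i : Fin 4)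
    (q : M) : ℝ :=
  diffReal (fun r => 2 * k₁ r + k₃ r + k₄ r) q (e i q)

namespace IsProperBiharmonicJordanOn

open IsJordanHypersurfaceOn

theorem mono (h : IsProperBiharmonicJordanOn x N k₁ k₃ k₄ U σ e) (hV : V ≤ U) :
    IsProperBiharmonicJordanOn x N k₁ k₃ k₄ V σ e where
  toIsJordanHypersurfaceOn := h.toIsJordanHypersurfaceOn.mono hV
  ne₁₃ q hq := h.ne₁₃ q (hV hq)
  ne₁₄ q hq := h.ne₁₄ q (hV hq)
  ne₃₄ q hq := h.ne₃₄ q (hV hq)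
  trace_ne q hq := h.trace_ne q (hV hq)
  biharmonic m q hq := h.biharmonic m q (hV hq)

theorem swap (h : IsProperBiharmonicJordanOn x N k₁ k₃ k₄ U σ e) :
    IsProperBiharmonicJordanOn x N k₁ k₄ k₃ U σ (fun i => e (Equiv.swap 2 3 i)) where
  toIsJordanHypersurfaceOn := h.toIsJordanHypersurfaceOn.swap
  ne₁₃ := h.ne₁₄
  ne₁₄ := h.ne₁₃
  ne₃₄ q hq := by
    rw [← neg_sub]
    exact neg_ne_zero.2 (h.ne₃₄ q hq)
  trace_ne q hq := by
    rw [trace_swap]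
    exact h.trace_ne q hq
  biharmonic := by
    simp only [trace_swap]
    exact h.biharmonic

theorem gradient_equations (h : IsProperBiharmonicJordanOn x N k₁ k₃ k₄ U σ e) {q : M}
    (hq : q ∈ U) :
    traceDeriv k₁ k₃ k₄ e 0 q = 0 ∧
    (2 * k₁ q + k₃ q + k₄ q + 2 * k₁ q) * traceDeriv k₁ k₃ k₄ e 1 q = 0 ∧
    (2 * k₁ q + k₃ q + k₄ q + 2 * k₃ q) * traceDeriv k₁ k₃ k₄ e 2 q = 0 ∧
    (2 * k₁ q + k₃ q + k₄ q + 2 * k₄ q) * traceDeriv k₁ k₃ k₄ e 3 q = 0 := by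
  obtain ⟨h0, h1, h2, h3⟩ := h.isAdaptedFrame.biharmonic_tangential
    (h.frameLaplace_trace_mul_normal h.biharmonic)
  have ev : ∀ {a b : smoothFunctions U}, a = b →
      evalSmooth (⟨q, hq⟩ : U) a = evalSmooth (⟨q, hq⟩ : U) b := fun h => congrArg _ h
  have hd : ∀ i, evalSmooth (⟨q, hq⟩ : U) (h.frame.deriv i (2 * h.c₁ + h.c₃ + h.c₄)) =
      traceDeriv k₁ k₃ k₄ e i q := h.eval_deriv_trace ⟨q, hq⟩
  replace h0 := ev h0
  replace h1 := ev h1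
  replace h2 := ev h2
  replace h3 := ev h3
  rw [map_mul, hd, map_zero] at h0 h2 h3
  rw [map_add, map_mul, map_mul, hd, hd, map_zero] at h1
  simp only [map_add, map_mul, AlgHom.map_ofNat_eq, eval_c₁, eval_c₃, eval_c₄] at h0 h1 h2 h3
  have h4 : traceDeriv k₁ k₃ k₄ e 0 q = 0 := by
    -- If `s₁ + 2k₁ = 0`, the Jordan term in the second equation still forces the derivative along
    -- `e 0` to vanish.
    rcases mul_eq_zero.1 h0 with h5 | h5
    · rw [h5] at h1
      linarith
    · exact h5
  rw [h4, mul_zero, add_zero] at h1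
  exact ⟨h4, h1, h2, h3⟩

theorem isOpen_traceDeriv_ne (h : IsProperBiharmonicJordanOn x N k₁ k₃ k₄ U σ e) (i : Fin 4) :
    IsOpen ((U : Set M) ∩ {q | traceDeriv k₁ k₃ k₄ e i q ≠ 0}) :=
  (contMDiffOn_diffReal_apply h.contMDiff_trace.contMDiffOn
    (h.frame.smooth i)).continuousOn.isOpen_inter_preimage U.2 isOpen_compl_singleton

/-- The derivative of the mean curvature in the direction of the second lightlike vector
vanishes. -/
theorem traceDeriv_one (h : IsProperBiharmonicJordanOn x N k₁ k₃ k₄ U σ e) {q : M} (hq : q ∈ U) :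
    traceDeriv k₁ k₃ k₄ e 1 q = 0 := by
  by_contra hne
  obtain ⟨V, hV⟩ : ∃ V : TopologicalSpace.Opens M,
      (V : Set M) = (U : Set M) ∩ {q | traceDeriv k₁ k₃ k₄ e 1 q ≠ 0} :=
    ⟨⟨_, h.isOpen_traceDeriv_ne 1⟩, rfl⟩
  have hVU : V ≤ U := fun r hr => (hV.subset hr).1
  have hne' : ∀ r ∈ V, traceDeriv k₁ k₃ k₄ e 1 r ≠ 0 := fun r hr => (hV.subset hr).2
  have hqV : q ∈ V := hV.superset ⟨hq, hne⟩
  replace h := h.mono hVU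
  have htr : ∀ r ∈ V, 2 * k₁ r + k₃ r + k₄ r = -2 * k₁ r := fun r hr => by
    have := (mul_eq_zero.1 (h.gradient_equations hr).2.1).resolve_right (hne' r hr)
    linarith
  -- With `s₁ = -2k₁` the factor `s₁ + 2k₃` is `2(k₃ - k₁)`, which is nonzero; similarly for `k₄`.
  have h2 : ∀ r ∈ V, traceDeriv k₁ k₃ k₄ e 2 r = 0 := fun r hr =>
    (mul_eq_zero.1 (h.gradient_equations hr).2.2.1).resolve_left fun h0 => h.ne₁₃ r hr (by
      linarith [htr r hr])
  have h3 : ∀ r ∈ V, traceDeriv k₁ k₃ k₄ e 3 r = 0 := fun r hr =>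
    (mul_eq_zero.1 (h.gradient_equations hr).2.2.2).resolve_left fun h0 => h.ne₁₄ r hr (by
      linarith [htr r hr])
  have hc : h.c₁ = algebraMap ℝ (smoothFunctions V) (-1 / 2) * (2 * h.c₁ + h.c₃ + h.c₄) :=
    smooth_ext fun r => by
      have := htr r r.2
      simp only [map_mul, map_add, AlgHom.commutes, AlgHom.map_ofNat_eq, eval_c₁, eval_c₃,
        eval_c₄, Algebra.algebraMap_self, RingHom.id_apply]
      linarith
  have hd : ∀ (r : V) i, evalSmooth r (h.frame.deriv i h.c₁) =
      -1 / 2 * traceDeriv k₁ k₃ k₄ e i r := by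
    intro r i
    rw [hc, Derivation.map_algebraMap_mul, map_mul, AlgHom.commutes, h.eval_deriv_trace]
    rfl
  have hk : ∀ r ∈ V, k₁ r ≠ 0 := fun r hr h0 => h.trace_ne r hr (by rw [htr r hr, h0, mul_zero])
  have hzero := h.isAdaptedFrame.eq_zero_of_jordan_eigenvalue
    (smooth_regular fun r => by rw [map_sub]; exact h.ne₁₃ r r.2)
    (smooth_regular fun r => by rw [map_sub]; exact h.ne₁₄ r r.2)
    (smooth_regular fun r => by rw [map_sub]; exact h.ne₃₄ r r.2)
    (smooth_regular fun r => hk r r.2)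
    (smooth_regular fun r => by
      rw [hd]
      exact mul_ne_zero (by norm_num) (hne' r r.2))
    (smooth_ext fun r => by
      have := htr r r.2
      simp only [map_mul, map_neg, map_add, AlgHom.map_ofNat_eq, eval_c₁, eval_c₃, eval_c₄]
      linarith)
    (smooth_ext fun r => by rw [hd, h2 r r.2, mul_zero, map_zero])
    (smooth_ext fun r => by rw [hd, h3 r r.2, mul_zero, map_zero])
  exact hk q hqV (congrArg (evalSmooth (⟨q, hqV⟩ : V)) hzero)

theorem trace_eq (h : IsProperBiharmonicJordanOn x N k₁ k₃ k₄ U σ e)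
    (hne : ∀ r ∈ U, traceDeriv k₁ k₃ k₄ e 2 r ≠ 0) {r : M} (hr : r ∈ U) :
    2 * k₁ r + k₃ r + k₄ r = -2 * k₃ r := by
  have := (mul_eq_zero.1 (h.gradient_equations hr).2.2.1).resolve_right (hne r hr)
  linarith

/-- The system of equations along the gradient lines of the mean curvature. -/
theorem exists_system (h : IsProperBiharmonicJordanOn x N k₁ k₃ k₄ U σ e)
    (hne : ∀ r ∈ U, traceDeriv k₁ k₃ k₄ e 2 r ≠ 0) :
    3 * h.c₃ = -2 * h.c₁ - h.c₄ ∧ ∃ p q : smoothFunctions U,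
      h.frame.deriv 2 h.c₁ = (h.c₁ - h.c₃) * p ∧ h.frame.deriv 2 h.c₄ = (h.c₄ - h.c₃) * q ∧
      h.frame.deriv 2 p = p ^ 2 + h.c₁ * h.c₃ ∧ h.frame.deriv 2 q = q ^ 2 + h.c₃ * h.c₄ ∧
      h.frame.deriv 2 (h.frame.deriv 2 h.c₃) = (2 * p + q) * h.frame.deriv 2 h.c₃ +
        h.c₃ * (2 * h.c₁ ^ 2 + h.c₃ ^ 2 + h.c₄ ^ 2) := by
  have h3 : ∀ r ∈ U, traceDeriv k₁ k₃ k₄ e 3 r = 0 := fun r hr =>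
    (mul_eq_zero.1 (h.gradient_equations hr).2.2.2).resolve_left fun h0 => h.ne₃₄ r hr (by
      linarith [h.trace_eq hne hr])
  have hc : h.c₃ = algebraMap ℝ (smoothFunctions U) (-1 / 2) * (2 * h.c₁ + h.c₃ + h.c₄) :=
    smooth_ext fun r => by
      have := h.trace_eq hne r.2
      simp only [map_mul, map_add, AlgHom.commutes, AlgHom.map_ofNat_eq, eval_c₁, eval_c₃,
        eval_c₄, Algebra.algebraMap_self, RingHom.id_apply]
      linarith
  have hd : ∀ (r : U) i, evalSmooth r (h.frame.deriv i h.c₃) =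
      -1 / 2 * traceDeriv k₁ k₃ k₄ e i r := by
    intro r i
    rw [hc, Derivation.map_algebraMap_mul, map_mul, AlgHom.commutes, h.eval_deriv_trace]
    rfl
  have htr : 3 * h.c₃ = -2 * h.c₁ - h.c₄ := smooth_ext fun r => by
    have := h.trace_eq hne r.2
    simp only [map_mul, map_neg, map_sub, AlgHom.map_ofNat_eq, eval_c₁, eval_c₃, eval_c₄]
    linarith
  refine ⟨htr, h.isAdaptedFrame.exists_system_of_simple_eigenvalue
    (smooth_regular fun r => by rw [map_sub]; exact h.ne₁₃ r r.2)
    (smooth_regular fun r => by rw [map_sub]; exact h.ne₁₄ r r.2)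
    (smooth_regular fun r => by rw [map_sub]; exact h.ne₃₄ r r.2)
    (smooth_regular fun r => by
      rw [hd]
      exact mul_ne_zero (by norm_num) (hne r r.2)) htr
    (smooth_ext fun r => by rw [hd, (h.gradient_equations r.2).1, mul_zero, map_zero])
    (smooth_ext fun r => by rw [hd, h.traceDeriv_one r.2, mul_zero, map_zero])
    (smooth_ext fun r => by rw [hd, h3 r r.2, mul_zero, map_zero])
    (h.isAdaptedFrame.biharmonic_normal fun m => ?_)⟩
  rw [hc, mul_assoc, frameLaplace_algebraMap_mul,
    h.frameLaplace_trace_mul_normal h.biharmonic, mul_zero]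

/-- The derivative of the mean curvature in the direction of the first simple eigenvector
vanishes. -/
theorem traceDeriv_two (h : IsProperBiharmonicJordanOn x N k₁ k₃ k₄ U σ e) {q : M} (hq : q ∈ U) :
    traceDeriv k₁ k₃ k₄ e 2 q = 0 := by
  by_contra hne
  obtain ⟨V, hV⟩ : ∃ V : TopologicalSpace.Opens M,
      (V : Set M) = (U : Set M) ∩ {q | traceDeriv k₁ k₃ k₄ e 2 q ≠ 0} :=
    ⟨⟨_, h.isOpen_traceDeriv_ne 2⟩, rfl⟩
  have hVU : V ≤ U := fun r hr => (hV.subset hr).1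
  have hne' : ∀ r ∈ V, traceDeriv k₁ k₃ k₄ e 2 r ≠ 0 := fun r hr => (hV.subset hr).2
  have hqV : q ∈ V := hV.superset ⟨hq, hne⟩
  replace h := h.mono hVU
  have hk : ∀ r ∈ V, k₃ r ≠ 0 := fun r hr h0 => h.trace_ne r hr (by
    rw [h.trace_eq hne' hr, h0, mul_zero])
  obtain ⟨ρ, hρ⟩ : ∃ ρ : M → ℝ, ρ = fun r => (k₁ r - k₃ r) / k₃ r := ⟨_, rfl⟩
  have hρc : ContinuousOn ρ V := by
    rw [hρ]
    exact (h.smooth₁.continuous.sub h.smooth₃.continuous).continuousOn.div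
      h.smooth₃.continuous.continuousOn hk
  have hroot : ∀ r ∈ V, elimResultant (ρ r) 1 = 0 := by
    intro r hr
    obtain ⟨htr, p, q, hp⟩ := h.exists_system hne'
    have h1 := congrArg (evalSmooth (⟨r, hr⟩ : V))
      (elimResultant_eq_zero htr hp.1 hp.2.1 hp.2.2.1 hp.2.2.2.1 hp.2.2.2.2)
    rw [map_elimResultant, map_zero, map_sub, eval_c₁, eval_c₃] at h1
    have h2 : k₁ r - k₃ r = ρ r * k₃ r := by
      rw [hρ]
      exact (div_mul_cancel₀ _ (hk r hr)).symm
    rw [h2, elimResultant_homogeneous] at h1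
    exact (mul_eq_zero.1 h1).resolve_left (pow_ne_zero _ (hk r hr))
  -- The roots other than `ρ q` form a finite, hence closed, set. Avoiding them leaves an open
  -- neighbourhood of `q` on which `ρ` is constant.
  obtain ⟨W, hW⟩ : ∃ W : TopologicalSpace.Opens M,
      (W : Set M) = (V : Set M) ∩ ρ ⁻¹' ({s : ℝ | elimResultant s 1 = 0} \ {ρ q})ᶜ :=
    ⟨⟨_, hρc.isOpen_inter_preimage V.2
      (finite_elimResultant_roots.subset Set.sdiff_subset).isClosed.isOpen_compl⟩, rfl⟩
  have hWV : W ≤ V := fun r hr => (hW.subset hr).1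
  have hqW : q ∈ W := hW.superset ⟨hqV, fun hmem => hmem.2 rfl⟩
  have hconst : ∀ r ∈ W, ρ r = ρ q := fun r hr => by
    by_contra h0
    exact (hW.subset hr).2 ⟨hroot r (hWV hr), h0⟩
  replace h := h.mono hWV
  obtain ⟨htr, p, p', hp⟩ := h.exists_system fun r hr => hne' r (hWV hr)
  -- The shift by 1 turns `ρ = (k₁ - k₃)/k₃` into `k₁/k₃`.
  refine not_constant_ratio (evalSmooth (⟨q, hqW⟩ : W)) (κ := ρ q + 1) (smooth_ext fun r => ?_)
    htr hp.1 hp.2.1 hp.2.2.1 hp.2.2.2.1 hp.2.2.2.2 (hk q hqV) (h.ne₁₃ q hqW) (h.ne₁₄ q hqW)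
    (h.ne₃₄ q hqW)
  have h3 := hconst r r.2
  rw [map_mul, AlgHom.commutes, eval_c₁, eval_c₃, ← h3, hρ]
  have := hk r (hWV r.2)
  change k₁ r = ((k₁ r - k₃ r) / k₃ r + 1) * k₃ r
  field_simp
  ring

theorem traceDeriv_three (h : IsProperBiharmonicJordanOn x N k₁ k₃ k₄ U σ e) {q : M}
    (hq : q ∈ U) : traceDeriv k₁ k₃ k₄ e 3 q = 0 := by
  have h1 := h.swap.traceDeriv_two hq
  simp only [traceDeriv, trace_swap] at h1
  exact h1

/-- All frame derivatives of `s₁` vanish, so the normal equation reduces to `s₁ (2k₁² + k₃² + k₄²) =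
0` with `s₁ ≠ 0`. -/
theorem false_of_mem (h : IsProperBiharmonicJordanOn x N k₁ k₃ k₄ U σ e) {q : M} (hq : q ∈ U) :
    False := by
  have hd : ∀ i, h.frame.deriv i (2 * h.c₁ + h.c₃ + h.c₄) = 0 := fun i => smooth_ext fun r => by
    rw [h.eval_deriv_trace, map_zero]
    fin_cases i
    exacts [(h.gradient_equations r.2).1, h.traceDeriv_one r.2, h.traceDeriv_two r.2,
      h.traceDeriv_three r.2]
  have h1 := congrArg (evalSmooth (⟨q, hq⟩ : U)) (h.isAdaptedFrame.biharmonic_normal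
    (h.frameLaplace_trace_mul_normal h.biharmonic))
  rw [frameLaplace_zero_of_deriv _ _ _ hd] at h1
  simp only [map_zero, map_mul, map_pow, map_add, AlgHom.map_ofNat_eq, eval_c₁, eval_c₃, eval_c₄,
    zero_add] at h1
  have h2 := (mul_eq_zero.1 h1).resolve_left (h.trace_ne q hq)
  have h3 : k₁ q = 0 := by nlinarith [sq_nonneg (k₁ q), sq_nonneg (k₃ q), sq_nonneg (k₄ q)]
  have h4 : k₃ q = 0 := by nlinarith [sq_nonneg (k₁ q), sq_nonneg (k₃ q), sq_nonneg (k₄ q)]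
  exact h.ne₁₃ q hq (by rw [h3, h4, sub_zero])

end IsProperBiharmonicJordanOn

end BiharmonicJordan
end

/-! ### From the local statements to the whole manifold. -/

theorem theorem3p2 {M : Type*} [TopologicalSpace M]
    [ChartedSpace (EuclideanSpace ℝ (Fin 4)) M] [IsManifold (𝓡 4) ∞ M]
    (x N : M → E51) (k₁ k₃ k₄ : M → ℝ)
    (hx : IsLorentzianHypersurface x) (hN : IsUnitNormal x N)
    (hS : HasCaseIShapeOperator x N k₁ k₃ k₄)
    (h₁₃ : ∀ p, k₁ p - k₃ p ≠ 0) (h₁₄ : ∀ p, k₁ p - k₄ p ≠ 0) (h₃₄ : ∀ p, k₃ p - k₄ p ≠ 0) :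
    (∀ p, meanCurvature x N p = 2 * k₁ p + k₃ p + k₄ p) ∧
      (IsBiharmonic x ↔ IsMinimal x N) := by
  have hJ : ∀ p : M, ∃ (U : TopologicalSpace.Opens M) (σ : ℝ)
      (e : Fin 4 → (q : M) → TangentSpace (𝓡 4) q),
      p ∈ U ∧ IsJordanHypersurfaceOn x N k₁ k₃ k₄ U σ e := by
    intro p
    obtain ⟨U, σ, e, hU, hp, he, hs⟩ := hS.frame p
    exact ⟨⟨U, hU⟩, σ, e, hp, hx.smooth, hN, hS.smooth₁, hS.smooth₃, hS.smooth₄, he,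
      fun q hq => (hs q hq).1, fun q hq => (hs q hq).2.1, fun q hq => (hs q hq).2.2.1,
      fun q hq => (hs q hq).2.2.2⟩
  have hmean : ∀ p, meanCurvature x N p = 2 * k₁ p + k₃ p + k₄ p := by
    intro p
    obtain ⟨U, σ, e, hp, h⟩ := hJ p
    exact h.meanCurvature_eq hp
  have hlap : ∀ m : Fin 5, laplace x (fun q => x q m) =
      fun q => -((2 * k₁ q + k₃ q + k₄ q) * N q m) := by
    intro m
    funext p
    obtain ⟨U, σ, e, hp, h⟩ := hJ p
    exact h.laplace_position hp m
  refine ⟨hmean, fun hb p => ?_, fun hmin m p => ?_⟩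
  · by_contra hne
    rw [hmean] at hne
    obtain ⟨U, σ, e, hp, h⟩ := hJ p
    obtain ⟨V, hV⟩ : ∃ V : TopologicalSpace.Opens M,
        (V : Set M) = (U : Set M) ∩ {q | 2 * k₁ q + k₃ q + k₄ q ≠ 0} :=
      ⟨⟨_, U.2.inter (isOpen_ne_fun h.contMDiff_trace.continuous continuous_const)⟩, rfl⟩
    have hB : IsProperBiharmonicJordanOn x N k₁ k₃ k₄ V σ e :=
      { toIsJordanHypersurfaceOn := h.mono fun r hr => (hV.subset hr).1
        ne₁₃ := fun q _ => h₁₃ q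
        ne₁₄ := fun q _ => h₁₄ q
        ne₃₄ := fun q _ => h₃₄ q
        trace_ne := fun q hq => (hV.subset hq).2
        biharmonic := fun m q _ => by
          rw [← hlap m]
          exact hb m q }
    exact hB.false_of_mem (hV.superset ⟨hp, hne⟩)
  · obtain ⟨U, σ, e, hp, h⟩ := hJ p
    have h0 : (fun q => -((2 * k₁ q + k₃ q + k₄ q) * N q m)) = fun _ => 0 := by
      funext q
      rw [← hmean q, hmin q, zero_mul, neg_zero]
    rw [hlap m, h0]
    exact h.laplace_zero hp
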